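/- A network consists of a directed graph with $n$ vertices and $m$ edges (without parallel edges), two distinct vertices $s$ and $t$, a capacity $c(e)\in\mathbb{R}$, $c(e)>0$, and an integer length $\ell(e)\ge 1$ for every edge $e$. For an integer $L\ge 0$ let $\mathcal{P}_L$ be the set of (simple) directed $s$-$t$ paths $P$ with $\sum_{e\in P}\ell(e)\le L$. An $L$-bounded flow is a function $x:\mathcal{P}_L\to[0,\infty)$ with $\sum_{P\in\mathcal{P}_L,\,e\in P}x(P)\le c(e)$ for every edge $e$, and its size is $\sum_{P\in\mathcal{P}_L}x(P)$. For $\rho\ge 1$, a $\rho$-approximation to the maximum $L$-bounded flow is an $L$-bounded flow $x$ such that every $L$-bounded flow has size at most $\rho$ times the size of $x$. Theorem. There are a single algorithm and a constant $C$ such that for every network with edge lengths, every integer $L\ge 0$ and every real $\varepsilon$ with $0<\varepsilon<1$, the algorithm, given the network, $L$ and $\varepsilon$ as its input, halts and outputs a $(1+\varepsilon)$-approximation to the maximum $L$-bounded flow, written as a list of paths with the amounts sent along them. If $m\ge 1$ and $L\ge 2$, then its running time is at most $$C\cdot\frac{m^2n}{\varepsilon^2}\,\log L\,\Bigl(\log\log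 n+\frac1\varepsilon\Bigr).$$ Running time is the number of steps on a real random access machine: the memory consists of finitely many arrays of natural numbers and of real numbers, the program is built from assignments, sequencing, conditionals and while loops, and every memory access, every arithmetic operation ($+$, truncated $-$, $\times$ on natural numbers; $+,-,\times,\div$ on reals; conversion of a natural number to a real) and every comparison is one step. The only constants in the program are natural numbers, and there is no conversion from reals to natural numbers. -/

import Mathlib

/-! ### Networks and `L`-bounded flows -/

/-- A network on the vertices `0, …, n - 1`: a directed graph without parallel edges, whose `m` edges
are numbered `0, …, m - 1`, with positive real capacities, positive integer lengths, and two
distinct distinguished vertices. -/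
structure Network (n m : ℕ) where
  tail : Fin m → Fin n
  head : Fin m → Fin n
  noParallel : ∀ e f : Fin m, tail e = tail f → head e = head f → e = f
  cap : Fin m → ℝ
  cap_pos : ∀ e, 0 < cap e
  len : Fin m → ℕ
  len_pos : ∀ e, 0 < len e
  source : Fin n
  sink : Fin n
  source_ne_sink : source ≠ sink

namespace Network

variable {n m : ℕ} (G : Network n m)

/-- The edge list `p` is a walk from `u` to `v`. -/
def IsWalk : Fin n → List (Fin m) → Fin n → Prop
  | u, [], v => u = v
  | u, e :: p, v => G.tail e = u ∧ IsWalk (G.head e) p v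

/-- The edge list `p` is a path from the source to the sink (no vertex is visited twice). -/
def IsPath (p : List (Fin m)) : Prop :=
  G.IsWalk G.source p G.sink ∧ (G.source :: p.map G.head).Nodup

/-- The set of source-sink paths of length at most `L`. -/
def boundedPaths (L : ℕ) : Set (List (Fin m)) :=
  {p | G.IsPath p ∧ (p.map G.len).sum ≤ L}

/-- `x` is a feasible `L`-bounded flow, given by the amount `x p` that it sends along each path
`p`: amounts are nonnegative, only source-sink paths of length at most `L` are used, and the
capacities are respected. -/
structure IsBoundedFlow (L : ℕ) (x : List (Fin m) →₀ ℝ) : Prop where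
  nonneg : ∀ p, 0 ≤ x p
  mem_boundedPaths : ∀ p ∈ x.support, p ∈ G.boundedPaths L
  le_cap : ∀ e : Fin m, ∑ p ∈ x.support with e ∈ p, x p ≤ G.cap e

end Network

/-- The size of a flow. -/
noncomputable def flowSize {m : ℕ} (x : List (Fin m) →₀ ℝ) : ℝ :=
  ∑ p ∈ x.support, x p

/-- `x` is a `ρ`-approximation to the maximum `L`-bounded flow in `G`: it is a feasible `L`-bounded
flow, and no feasible `L`-bounded flow is larger than `ρ` times its size. -/
def Network.IsApproxMaxFlow {n m : ℕ} (G : Network n m) (L : ℕ) (ρ : ℝ)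
    (x : List (Fin m) →₀ ℝ) : Prop :=
  G.IsBoundedFlow L x ∧
    ∀ x' : List (Fin m) →₀ ℝ, G.IsBoundedFlow L x' → flowSize x' ≤ ρ * flowSize x

/-! ### A real random access machine

Programs of a structured random access machine with integer and real memory, at unit cost.
The memory consists of arrays of natural numbers and arrays of real numbers. A program names its
arrays by fixed numbers and so uses finitely many of them; the positions inside an array are
computed at run time. The only constants are natural numbers, integers may be converted to reals,
and there is neither a conversion from reals to integers (no rounding) nor a root or a
logarithm. -/

namespace RealRAM

structure Memory where
  nat : ℕ → ℕ → ℕ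
  real : ℕ → ℕ → ℝ

/-- Integer expressions; `get a i` reads position `i` of the integer array `a`. -/
inductive NatExpr where
  | const (k : ℕ)
  | get (a : ℕ) (i : NatExpr)
  | add (e f : NatExpr)
  | sub (e f : NatExpr)
  | mul (e f : NatExpr)

/-- Real expressions; `get a i` reads position `i` of the real array `a`. -/
inductive RealExpr where
  | ofNat (e : NatExpr)
  | get (a : ℕ) (i : NatExpr)
  | add (e f : RealExpr)
  | sub (e f : RealExpr)
  | mul (e f : RealExpr)
  | div (e f : RealExpr)

inductive Test where
  | natLe (e f : NatExpr)
  | realLe (e f : RealExpr)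
  | neg (b : Test)
  | both (b c : Test)

inductive Program where
  | skip
  | setNat (a : ℕ) (i e : NatExpr)
  | setReal (a : ℕ) (i : NatExpr) (e : RealExpr)
  | seq (P Q : Program)
  | cond (b : Test) (P Q : Program)
  | loop (b : Test) (P : Program)

/-- The value of an integer expression (subtraction is truncated at `0`). -/
def NatExpr.eval (μ : Memory) : NatExpr → ℕ
  | const k => k
  | get a i => μ.nat a (i.eval μ)
  | add e f => e.eval μ + f.eval μ
  | sub e f => e.eval μ - f.eval μ
  | mul e f => e.eval μ * f.eval μ

/-- The number of steps that the evaluation takes: one for each constant, memory access and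
arithmetic operation. -/
def NatExpr.cost : NatExpr → ℕ
  | const _ => 1
  | get _ i => i.cost + 1
  | add e f => e.cost + f.cost + 1
  | sub e f => e.cost + f.cost + 1
  | mul e f => e.cost + f.cost + 1

/-- The value of a real expression (a division by `0` returns `0`). -/
noncomputable def RealExpr.eval (μ : Memory) : RealExpr → ℝ
  | ofNat e => (e.eval μ : ℝ)
  | get a i => μ.real a (i.eval μ)
  | add e f => e.eval μ + f.eval μ
  | sub e f => e.eval μ - f.eval μ
  | mul e f => e.eval μ * f.eval μ
  | div e f => e.eval μ / f.eval μ

def RealExpr.cost : RealExpr → ℕ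
  | ofNat e => e.cost + 1
  | get _ i => i.cost + 1
  | add e f => e.cost + f.cost + 1
  | sub e f => e.cost + f.cost + 1
  | mul e f => e.cost + f.cost + 1
  | div e f => e.cost + f.cost + 1

/-- The test succeeds. -/
def Test.Holds (μ : Memory) : Test → Prop
  | natLe e f => e.eval μ ≤ f.eval μ
  | realLe e f => e.eval μ ≤ f.eval μ
  | neg b => ¬ b.Holds μ
  | both b c => b.Holds μ ∧ c.Holds μ

def Test.cost : Test → ℕ
  | natLe e f => e.cost + f.cost + 1
  | realLe e f => e.cost + f.cost + 1
  | neg b => b.cost + 1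
  | both b c => b.cost + c.cost + 1

/-- Write `k` into position `i` of the integer array `a`. -/
def Memory.setNat (μ : Memory) (a i k : ℕ) : Memory :=
  { μ with nat := Function.update μ.nat a (Function.update (μ.nat a) i k) }

/-- Write `r` into position `i` of the real array `a`. -/
def Memory.setReal (μ : Memory) (a i : ℕ) (r : ℝ) : Memory :=
  { μ with real := Function.update μ.real a (Function.update (μ.real a) i r) }

/-- `Exec P μ μ' T`: started on the memory `μ`, the program `P` halts after exactly `T` steps with
the memory `μ'`. -/
inductive Exec : Program → Memory → Memory → ℕ → Prop where
  | skip (μ : Memory) : Exec .skip μ μ 1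
  | setNat (μ : Memory) (a : ℕ) (i e : NatExpr) :
      Exec (.setNat a i e) μ (μ.setNat a (i.eval μ) (e.eval μ)) (i.cost + e.cost + 1)
  | setReal (μ : Memory) (a : ℕ) (i : NatExpr) (e : RealExpr) :
      Exec (.setReal a i e) μ (μ.setReal a (i.eval μ) (e.eval μ)) (i.cost + e.cost + 1)
  | seq {P Q : Program} {μ₁ μ₂ μ₃ : Memory} {T₁ T₂ : ℕ} :
      Exec P μ₁ μ₂ T₁ → Exec Q μ₂ μ₃ T₂ → Exec (.seq P Q) μ₁ μ₃ (T₁ + T₂)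
  | condTrue {b : Test} {P Q : Program} {μ μ' : Memory} {T : ℕ} :
      b.Holds μ → Exec P μ μ' T → Exec (.cond b P Q) μ μ' (b.cost + T)
  | condFalse {b : Test} {P Q : Program} {μ μ' : Memory} {T : ℕ} :
      ¬ b.Holds μ → Exec Q μ μ' T → Exec (.cond b P Q) μ μ' (b.cost + T)
  | loopDone {b : Test} {P : Program} {μ : Memory} :
      ¬ b.Holds μ → Exec (.loop b P) μ μ b.cost
  | loopStep {b : Test} {P : Program} {μ₁ μ₂ μ₃ : Memory} {T₁ T₂ : ℕ} :
      b.Holds μ₁ → Exec P μ₁ μ₂ T₁ → Exec (.loop b P) μ₂ μ₃ T₂ →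
        Exec (.loop b P) μ₁ μ₃ (b.cost + T₁ + T₂)

/-- The array with the values `g 0, …, g (k - 1)`, followed by zeros. -/
def arrayOf {α : Type} [Zero α] {k : ℕ} (g : Fin k → α) (i : ℕ) : α :=
  if h : i < k then g ⟨i, h⟩ else 0

/-- The initial memory for the instance `(G, L, ε)`. Integer array `0` holds `n`, `m`, the source,
the sink and `L`; integer arrays `1`, `2`, `3` hold the tails, heads and lengths of the edges;
real array `0` holds `ε` and real array `1` the capacities. Everything else is zero. -/
def inputMemory {n m : ℕ} (G : Network n m) (L : ℕ) (ε : ℝ) : Memory where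
  nat
    | 0 => arrayOf ![n, m, (G.source : ℕ), (G.sink : ℕ), L]
    | 1 => arrayOf fun e => (G.tail e : ℕ)
    | 2 => arrayOf fun e => (G.head e : ℕ)
    | 3 => arrayOf G.len
    | _ => fun _ => 0
  real
    | 0 => arrayOf ![ε]
    | 1 => arrayOf G.cap
    | _ => fun _ => 0

/-- The flow `x` is written in the memory `μ` as a list of paths with nonnegative amounts. Position
`0` of integer array `4` is the number of listed paths. The `j`-th one has `μ.nat 6 j` edges,
whose numbers stand in integer array `7` from position `μ.nat 5 j` on, and the amount sent along
it is `μ.real 2 j`. A path may be listed several times, its amounts are then added up. -/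
def HoldsFlow {m : ℕ} (μ : Memory) (x : List (Fin m) →₀ ℝ) : Prop :=
  ∃ p : ℕ → List (Fin m),
    (∀ j < μ.nat 4 0,
      (p j).map (fun e => (e : ℕ)) =
          (List.range (μ.nat 6 j)).map (fun i => μ.nat 7 (μ.nat 5 j + i)) ∧
        0 ≤ μ.real 2 j) ∧
    x = ∑ j ∈ Finset.range (μ.nat 4 0), Finsupp.single (p j) (μ.real 2 j)

end RealRAM

/-! The algorithm is the multiplicative weights method of Garg and Könemann, with Fleischer's
monotone distance estimate. Every edge has a price `y e`, at first `1`, and `α = (1 + 1 / k) ^ r` is a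
lower bound for the price of every bounded path, where `k` is about `4 / ε`. In each round, either some
bounded path has a price of at most `(1 + 2 / k) * α`; then its smallest capacity `u` is sent along
it, and the price of each of its edges is multiplied by `1 + u / (k * cap e)`. Or all bounded paths
cost at least `(1 + 1 / k) * α`, and `r` grows by one. After `N - 3` raises, where
`N = k * (q + k + 3)` and `L ≤ (1 + 1 / k) ^ q`, the flow divided by `N` is the answer.

It is feasible because by Bernoulli's inequality an edge with load `t * cap e` has a price of at
least `(1 + 1 / k) ^ t`, while no price exceeds `(1 + 1 / k) ^ N`. It is nearly optimal because of weak
duality (`Network.IsBoundedFlow.mul_size_le`): the prices minus one give every bounded path at least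
`α - L`, so `W = ∑ cap e * (y e - 1)` is at least `α - L` times the size of any feasible flow, and an
augmentation increases `W` by at most `(1 + 2 / k) * α * u / k`. Hence the potential
`(1 / k) * (1 + 2 / k) * (amount sent) - W / α` does not decrease in augmentations and gains almost
`1 / k` times the maximum with each raise beyond `q`. `PriceInvariant` records all of this. There are
at most `(m + 1) * N` rounds, since an augmentation multiplies the product of the prices by at
least `1 + 1 / k`.

A round decides between its two cases with integer weights `w e`, the prices divided by `α / (k * n)`
and rounded up (`RoundedWeights`), and a table over the weights up to `n * (k + 2)` of the shortest
lengths of walks to the sink of exactly that weight (`SlackTable`). As the weights are positive, a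
bounded walk of minimum weight is a path. The monotone estimate makes a search for the scale of the
optimum unnecessary, so that a round takes `O(m * n * k)` steps. Since `q = O(k * log L)`, the total
is `O(m ^ 2 * n * k ^ 3 * log L)`, which is within the bound even without its double logarithm.

The program is verified with `Reach`, a total correctness judgement with a time bound, and
`SameExcept`, which says which arrays a piece of the program leaves alone. -/

/-! ### Loads, walks and weak duality -/

/-- The total amount that the flow `x` sends through the edge `e`. -/
noncomputable def edgeLoad {m : ℕ} (x : List (Fin m) →₀ ℝ) (e : Fin m) : ℝ :=
  ∑ p ∈ x.support with e ∈ p, x p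

theorem edgeLoad_eq_sum {m : ℕ} (x : List (Fin m) →₀ ℝ) (e : Fin m) :
    edgeLoad x e = x.sum fun p a => if e ∈ p then a else 0 := by
  simp [edgeLoad, Finsupp.sum, Finset.sum_filter]

theorem edgeLoad_add_single {m : ℕ} (x : List (Fin m) →₀ ℝ) (p : List (Fin m)) (a : ℝ)
    (e : Fin m) :
    edgeLoad (x + Finsupp.single p a) e = edgeLoad x e + if e ∈ p then a else 0 := by
  rw [edgeLoad_eq_sum, edgeLoad_eq_sum, Finsupp.sum_add_index', Finsupp.sum_single_index]
  · simp
  · simp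
  · intro q b c
    split_ifs <;> simp

theorem flowSize_add_single {m : ℕ} (x : List (Fin m) →₀ ℝ) (p : List (Fin m)) (a : ℝ) :
    flowSize (x + Finsupp.single p a) = flowSize x + a := by
  change (x + Finsupp.single p a).sum (fun _ b => b) = x.sum (fun _ b => b) + a
  rw [Finsupp.sum_add_index', Finsupp.sum_single_index] <;> simp

theorem flowSize_nonneg {m : ℕ} {x : List (Fin m) →₀ ℝ} (hx : ∀ p, 0 ≤ x p) : 0 ≤ flowSize x :=
  Finset.sum_nonneg fun p _ => hx p

theorem list_sum_map_eq_sum_ite {m : ℕ} {p : List (Fin m)} (hp : p.Nodup) (z : Fin m → ℝ) :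
    (p.map z).sum = ∑ e, if e ∈ p then z e else 0 := by
  rw [← List.sum_toFinset z hp, ← Finset.sum_filter]
  congr 1
  ext e
  simp

theorem length_le_sum_map {α : Type*} {w : α → ℕ} (hw : ∀ a, 0 < w a) (p : List α) :
    p.length ≤ (p.map w).sum := by
  have := List.card_nsmul_le_sum (p.map w) 1 (by
    intro x hx
    obtain ⟨a, -, rfl⟩ := List.mem_map.1 hx
    exact hw a)
  simpa using this

namespace Network

variable {n m : ℕ} {G : Network n m} {L : ℕ}

theorem isWalk_append {u v : Fin n} {p q : List (Fin m)} :
    G.IsWalk u (p ++ q) v ↔ ∃ a, G.IsWalk u p a ∧ G.IsWalk a q v := by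
  induction p generalizing u with
  | nil => simp [IsWalk]
  | cons e p ih => simp [IsWalk, ih, and_assoc]

theorem isWalk_concat {u v a : Fin n} {p : List (Fin m)} {e : Fin m} (h : G.IsWalk u p a)
    (ha : G.tail e = a) (hv : G.head e = v) : G.IsWalk u (p ++ [e]) v :=
  isWalk_append.2 ⟨a, h, ha, hv⟩

theorem exists_suffix_of_mem {u v a : Fin n} {p : List (Fin m)} (h : G.IsWalk a p v)
    (hu : u ∈ p.map G.head) : ∃ c q, p = c ++ q ∧ c ≠ [] ∧ G.IsWalk u q v := by
  induction p generalizing a with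
  | nil => simp at hu
  | cons e p ih =>
    by_cases he : G.head e = u
    · exact ⟨[e], p, rfl, by simp, he ▸ h.2⟩
    · have hu' : u ∈ p.map G.head := by
        rcases List.mem_cons.1 (by simpa only [List.map_cons] using hu) with h | h
        · exact absurd h.symm he
        · exact h
      obtain ⟨c, q, rfl, -, hq⟩ := ih h.2 hu'
      exact ⟨e :: c, q, rfl, by simp, hq⟩

/-- A walk that visits a vertex twice can be shortened by cutting out a closed walk `c`. -/
theorem exists_shortcut {u v : Fin n} {p : List (Fin m)} (h : G.IsWalk u p v)
    (hp : ¬ (u :: p.map G.head).Nodup) :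
    ∃ c q, p.Perm (c ++ q) ∧ c ≠ [] ∧ G.IsWalk u q v := by
  induction p generalizing u with
  | nil => simp at hp
  | cons e p ih =>
    by_cases hu : u ∈ (e :: p).map G.head
    · obtain ⟨c, q, hc, h'⟩ := exists_suffix_of_mem h hu
      exact ⟨c, q, by rw [hc], h'⟩
    · have hp' : ¬ (G.head e :: p.map G.head).Nodup := fun hn =>
        hp (List.nodup_cons.2 ⟨hu, hn⟩)
      obtain ⟨c, q, hc, hne, hq⟩ := ih h.2 hp'
      exact ⟨c, e :: q, (hc.cons e).trans List.perm_middle.symm, hne, h.1, hq⟩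

theorem IsPath.nodup {p : List (Fin m)} (hp : G.IsPath p) : p.Nodup :=
  (List.nodup_cons.1 hp.2).2.of_map

theorem IsPath.ne_nil {p : List (Fin m)} (hp : G.IsPath p) : p ≠ [] := by
  rintro rfl
  exact G.source_ne_sink hp.1

theorem IsPath.length_lt {p : List (Fin m)} (hp : G.IsPath p) : p.length < n := by
  have := hp.2.length_le_card
  simpa [Nat.succ_le_iff] using this

theorem length_le_of_mem_boundedPaths {p : List (Fin m)} (hp : p ∈ G.boundedPaths L) :
    p.length ≤ L :=
  (length_le_sum_map G.len_pos p).trans hp.2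

/-- Weak duality: edge prices `z` that give every bounded path a price of at least `β` bound the
size of every feasible flow. -/
theorem IsBoundedFlow.mul_size_le {x : List (Fin m) →₀ ℝ} (hx : G.IsBoundedFlow L x)
    {z : Fin m → ℝ} (hz : ∀ e, 0 ≤ z e) {β : ℝ}
    (hβ : ∀ p ∈ G.boundedPaths L, β ≤ (p.map z).sum) :
    flowSize x * β ≤ ∑ e, G.cap e * z e := by
  calc flowSize x * β = ∑ p ∈ x.support, x p * β := by rw [flowSize, Finset.sum_mul]
    _ ≤ ∑ p ∈ x.support, ∑ e, (if e ∈ p then x p * z e else 0) := by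
        refine Finset.sum_le_sum fun p hp => ?_
        have hpb := hx.mem_boundedPaths p hp
        refine (mul_le_mul_of_nonneg_left (hβ p hpb) (hx.nonneg p)).trans (le_of_eq ?_)
        rw [list_sum_map_eq_sum_ite hpb.1.nodup, Finset.mul_sum]
        exact Finset.sum_congr rfl fun e _ => by simp
    _ = ∑ e, edgeLoad x e * z e := by
        rw [Finset.sum_comm]
        refine Finset.sum_congr rfl fun e _ => ?_
        rw [edgeLoad, Finset.sum_filter, Finset.sum_mul]
        exact Finset.sum_congr rfl fun p _ => by simp
    _ ≤ _ := Finset.sum_le_sum fun e _ => mul_le_mul_of_nonneg_right (hx.le_cap e) (hz e)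

end Network

/-! ### The potential argument -/

/-- The invariant of the multiplicative weights scheme with step width `1 / k`. The edge prices
are `y`, the distance estimate is `(1 + 1 / k) ^ r`, the flow routed so far, divided by `N`, is
`x`, and it was routed in `J` augmentations. The estimate has passed `L` when `q ≤ r`; from then on,
`near_optimal` bounds the size of every feasible flow `x'` by the potential, and before that `gain`
says that the potential is nonnegative. -/
structure PriceInvariant {n m : ℕ} (G : Network n m) (L k q N : ℕ) (y : Fin m → ℝ) (r : ℕ)
    (x : List (Fin m) →₀ ℝ) (J : ℕ) : Prop where
  one_le : ∀ e, 1 ≤ y e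
  le_pow : ∀ e, y e ≤ (1 + 1 / (k : ℝ)) ^ (r + 3)
  nonneg : ∀ p, 0 ≤ x p
  mem_boundedPaths : ∀ p ∈ x.support, p ∈ G.boundedPaths L
  load : ∀ e, (1 + 1 / (k : ℝ)) ^ (edgeLoad x e * N / G.cap e) ≤ y e
  count : (1 + 1 / (k : ℝ)) ^ J ≤ ∏ e, y e
  dist : ∀ p ∈ G.boundedPaths L, (1 + 1 / (k : ℝ)) ^ r ≤ (p.map y).sum
  gain : (∑ e, G.cap e * (y e - 1)) / (1 + 1 / (k : ℝ)) ^ r ≤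
    1 / k * (1 + 2 / k) * (N * flowSize x)
  near_optimal : q ≤ r → ∀ x', G.IsBoundedFlow L x' →
    1 / k * flowSize x' * ((r : ℝ) - q - k + k * L / (1 + 1 / (k : ℝ)) ^ r) ≤
      1 / k * (1 + 2 / k) * (N * flowSize x) -
        (∑ e, G.cap e * (y e - 1)) / (1 + 1 / (k : ℝ)) ^ r

namespace PriceInvariant

variable {n m : ℕ} {G : Network n m} {L k q N : ℕ} {y : Fin m → ℝ} {r : ℕ}
  {x : List (Fin m) →₀ ℝ} {J : ℕ}

/-- With the estimate equal to `L` or more, the term that depends on `L` costs nothing. -/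
theorem slack_nonpos (hq : (L : ℝ) ≤ (1 + 1 / (k : ℝ)) ^ q) :
    ((q : ℝ) - q - k + k * L / (1 + 1 / (k : ℝ)) ^ q) ≤ 0 := by
  have hb : (0 : ℝ) < (1 + 1 / (k : ℝ)) ^ q := by positivity
  have : (k : ℝ) * L / (1 + 1 / (k : ℝ)) ^ q ≤ k := by
    rw [div_le_iff₀ hb]
    exact mul_le_mul_of_nonneg_left hq (by positivity)
  linarith

theorem init (hq : (L : ℝ) ≤ (1 + 1 / (k : ℝ)) ^ q) :
    PriceInvariant G L k q N (fun _ => 1) 0 0 0 where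
  one_le _ := le_rfl
  le_pow _ := one_le_pow₀ (by simp)
  nonneg := by simp
  mem_boundedPaths := by simp
  load e := by simp [edgeLoad]
  count := by simp
  dist p hp := by
    have : 1 ≤ p.length := List.length_pos_iff.2 hp.1.ne_nil
    simpa using this
  gain := by simp [flowSize]
  near_optimal h x' hx' := by
    obtain rfl : q = 0 := by omega
    have h1 := slack_nonpos hq
    have h2 : 0 ≤ 1 / (k : ℝ) * flowSize x' :=
      mul_nonneg (by positivity) (flowSize_nonneg hx'.nonneg)
    simpa [flowSize] using mul_nonpos_of_nonneg_of_nonpos h2 h1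

/-- The distance estimate may grow by a factor `1 + 1 / k` once it is a lower bound. The loss
term `L / (1 + 1 / k) ^ r` telescopes as a geometric series. -/
theorem raise (h : PriceInvariant G L k q N y r x J) (hk : 0 < k)
    (hq : (L : ℝ) ≤ (1 + 1 / (k : ℝ)) ^ q)
    (hd : ∀ p ∈ G.boundedPaths L, (1 + 1 / (k : ℝ)) ^ (r + 1) ≤ (p.map y).sum) :
    PriceInvariant G L k q N y (r + 1) x J := by
  have hk' : (0 : ℝ) < k := by exact_mod_cast hk
  set b : ℝ := 1 + 1 / (k : ℝ) with hb
  have hb1 : 1 ≤ b := by simp [hb]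
  have hb0 : 0 < b := by linarith
  have hbr : 0 < b ^ r := by positivity
  set W := ∑ e, G.cap e * (y e - 1) with hW
  have hW0 : 0 ≤ W := Finset.sum_nonneg fun e _ =>
    mul_nonneg (G.cap_pos e).le (by linarith [h.one_le e])
  have hWle : W / b ^ (r + 1) ≤ W / b ^ r :=
    div_le_div_of_nonneg_left hW0 hbr (pow_le_pow_right₀ hb1 (by omega))
  refine ⟨h.one_le, fun e => (h.le_pow e).trans (pow_le_pow_right₀ hb1 (by omega)), h.nonneg,
    h.mem_boundedPaths, h.load, h.count, hd, hWle.trans h.gain, fun hqr x' hx' => ?_⟩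
  have hF := flowSize_nonneg hx'.nonneg
  rcases Nat.lt_or_ge r q with hlt | hge
  · obtain rfl : q = r + 1 := by omega
    have h1 := slack_nonpos hq
    have h2 : 0 ≤ 1 / (k : ℝ) * flowSize x' := mul_nonneg (by positivity) hF
    have h3 := mul_nonpos_of_nonneg_of_nonpos h2 h1
    have h4 := hWle.trans h.gain
    linarith
  · have h1 := h.near_optimal hge x' hx'
    have h2 : flowSize x' * (b ^ (r + 1) - L) ≤ W := by
      refine hx'.mul_size_le (fun e => by linarith [h.one_le e]) fun p hp => ?_
      have hlen : (p.length : ℝ) ≤ L := by exact_mod_cast Network.length_le_of_mem_boundedPaths hp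
      have : (p.map fun e => y e - 1).sum = (p.map y).sum - p.length := by
        clear hlen hp
        induction p with
        | nil => simp
        | cons e p ih => simp [ih]; ring
      have := hd p hp
      linarith
    have h3 : flowSize x' * (1 - L / b ^ (r + 1)) ≤ W / b ^ (r + 1) := by
      rw [le_div_iff₀ (by positivity)]
      calc _ = flowSize x' * (b ^ (r + 1) - L) := by field_simp
        _ ≤ W := h2
    have h4 : W / b ^ r - W / b ^ (r + 1) = 1 / k * (W / b ^ (r + 1)) := by
      rw [pow_succ]; field_simp; rw [hb]; field_simp; ring
    have h5 : (k : ℝ) * L / b ^ r - k * L / b ^ (r + 1) = L / b ^ (r + 1) := by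
      rw [pow_succ]; field_simp; rw [hb]; field_simp; ring
    have h6 := mul_le_mul_of_nonneg_left h3 (by positivity : 0 ≤ 1 / (k : ℝ))
    push_cast
    calc 1 / (k : ℝ) * flowSize x' * ((r : ℝ) + 1 - q - k + k * L / b ^ (r + 1))
        = 1 / (k : ℝ) * flowSize x' * ((r : ℝ) - q - k + k * L / b ^ r) +
          1 / k * (flowSize x' * (1 - L / b ^ (r + 1))) := by rw [← h5]; ring
      _ ≤ _ := by linarith

/-- Sending `u`, the smallest capacity on `p`, along a path whose price exceeds the estimate by a
factor of at most `1 + 2 / k`. The bottleneck edge's price grows by the factor `1 + 1 / k`, and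
Bernoulli's inequality relates the growth of the other prices to their loads. -/
theorem augment (h : PriceInvariant G L k q N y r x J) (hk : 0 < k) (hN : 0 < N)
    {p : List (Fin m)} (hp : p ∈ G.boundedPaths L)
    (hcost : (p.map y).sum ≤ (1 + 2 / (k : ℝ)) * (1 + 1 / (k : ℝ)) ^ r)
    {u : ℝ} (hu : ∀ e ∈ p, u ≤ G.cap e) (hu' : ∃ e ∈ p, u = G.cap e) :
    PriceInvariant G L k q N (fun e => if e ∈ p then y e * (1 + u / (k * G.cap e)) else y e) r
      (x + Finsupp.single p (u / N)) (J + 1) := by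
  have hk' : (0 : ℝ) < k := by exact_mod_cast hk
  have hN' : (0 : ℝ) < N := by exact_mod_cast hN
  set b : ℝ := 1 + 1 / (k : ℝ) with hb
  have hb1 : 1 ≤ b := by simp [hb]
  have hb0 : 0 < b := by linarith
  have hbr : 0 < b ^ r := by positivity
  obtain ⟨e₀, he₀, hue₀⟩ := hu'
  have hu0 : 0 < u := hue₀ ▸ G.cap_pos e₀
  have hfac : ∀ e, 0 ≤ u / (k * G.cap e) := fun e =>
    div_nonneg hu0.le (mul_nonneg hk'.le (G.cap_pos e).le)
  have hfac' : ∀ e ∈ p, 1 + u / (k * G.cap e) ≤ b := fun e he => by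
    have hc := G.cap_pos e
    have : u / (k * G.cap e) ≤ 1 / k := by
      rw [div_le_div_iff₀ (by positivity) hk']
      nlinarith [hu e he]
    linarith
  have hy0 : ∀ e, 0 < y e := fun e => by linarith [h.one_le e]
  have hyle : ∀ e, y e ≤ if e ∈ p then y e * (1 + u / (k * G.cap e)) else y e := fun e => by
    split_ifs
    · nlinarith [mul_nonneg (hy0 e).le (hfac e)]
    · exact le_rfl
  have hW : ∑ e, G.cap e * ((if e ∈ p then y e * (1 + u / (k * G.cap e)) else y e) - 1) =
      ∑ e, G.cap e * (y e - 1) + 1 / k * u * (p.map y).sum := by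
    rw [list_sum_map_eq_sum_ite hp.1.nodup, Finset.mul_sum, ← Finset.sum_add_distrib]
    refine Finset.sum_congr rfl fun e _ => ?_
    have hc := (G.cap_pos e).ne'
    split_ifs
    · field_simp; ring
    · ring
  have hWle : (∑ e, G.cap e * ((if e ∈ p then y e * (1 + u / (k * G.cap e)) else y e) - 1)) / b ^ r
      ≤ (∑ e, G.cap e * (y e - 1)) / b ^ r + 1 / k * (1 + 2 / k) * u := by
    rw [hW, add_div]
    gcongr
    rw [div_le_iff₀ hbr]
    calc 1 / k * u * (p.map y).sum ≤ 1 / k * u * ((1 + 2 / (k : ℝ)) * b ^ r) := by gcongr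
      _ = _ := by ring
  have hsize : (N : ℝ) * flowSize (x + Finsupp.single p (u / N)) = N * flowSize x + u := by
    rw [flowSize_add_single]; field_simp
  refine ⟨fun e => (h.one_le e).trans (hyle e), fun e => ?_, fun p' => ?_, fun p' hp' => ?_,
    fun e => ?_, ?_, fun p' hp' => ?_, ?_, fun hqr x' hx' => ?_⟩
  · split_ifs with he
    · have h1 : y e ≤ (p.map y).sum := by
        refine List.single_le_sum ?_ _ (List.mem_map_of_mem he)
        intro z hz
        obtain ⟨f, -, rfl⟩ := List.mem_map.1 hz
        exact (hy0 f).le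
      have h2 : 1 + 2 / (k : ℝ) ≤ b ^ 2 := by
        have : b ^ 2 = 1 + 2 / (k : ℝ) + (1 / k) ^ 2 := by rw [hb]; ring
        rw [this]; nlinarith [sq_nonneg (1 / (k : ℝ))]
      calc y e * (1 + u / (k * G.cap e)) ≤ (b ^ 2 * b ^ r) * b := by
            refine mul_le_mul ?_ (hfac' e he) (by linarith [hfac e]) (by positivity)
            exact h1.trans (hcost.trans (mul_le_mul_of_nonneg_right h2 hbr.le))
        _ = b ^ (r + 3) := by ring
    · exact h.le_pow e
  · rw [Finsupp.add_apply]
    refine add_nonneg (h.nonneg p') ?_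
    rw [Finsupp.single_apply]
    split_ifs
    · positivity
    · exact le_rfl
  · rcases Finset.mem_union.1 (Finsupp.support_add hp') with h1 | h1
    · exact h.mem_boundedPaths p' h1
    · rw [Finset.mem_singleton.1 (Finsupp.support_single_subset h1)]
      exact hp
  · rw [edgeLoad_add_single]
    split_ifs with he
    · have hc := G.cap_pos e
      have h1 : (edgeLoad x e + u / N) * N / G.cap e =
          edgeLoad x e * N / G.cap e + u / G.cap e := by field_simp
      rw [h1, Real.rpow_add hb0]
      refine mul_le_mul (h.load e) ?_ (by positivity) (hy0 e).le
      have h2 := rpow_one_add_le_one_add_mul_self (s := 1 / (k : ℝ)) (p := u / G.cap e)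
        (by have : (0 : ℝ) ≤ 1 / k := by positivity
            linarith) (by positivity) ((div_le_one hc).2 (hu e he))
      refine h2.trans (le_of_eq ?_)
      field_simp
    · simpa using h.load e
  · have h1 : (∏ e, y e) * b ≤
        ∏ e, if e ∈ p then y e * (1 + u / (k * G.cap e)) else y e := by
      rw [← Finset.mul_prod_erase _ _ (Finset.mem_univ e₀),
        ← Finset.mul_prod_erase _ (fun e => if e ∈ p then _ else _) (Finset.mem_univ e₀),
        if_pos he₀]
      have h2 : 1 + u / (k * G.cap e₀) = b := by
        have := (G.cap_pos e₀).ne'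
        rw [hue₀, hb]; field_simp
      rw [h2]
      have h3 : ∏ e ∈ Finset.univ.erase e₀, y e ≤ ∏ e ∈ Finset.univ.erase e₀,
          if e ∈ p then y e * (1 + u / (k * G.cap e)) else y e :=
        Finset.prod_le_prod (fun e _ => (hy0 e).le) fun e _ => hyle e
      calc y e₀ * (∏ e ∈ Finset.univ.erase e₀, y e) * b
          = y e₀ * b * ∏ e ∈ Finset.univ.erase e₀, y e := by ring
        _ ≤ _ := mul_le_mul_of_nonneg_left h3 (mul_nonneg (hy0 e₀).le hb0.le)
    rw [pow_succ]
    exact (mul_le_mul_of_nonneg_right h.count hb0.le).trans h1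
  · refine (h.dist p' hp').trans ?_
    exact List.sum_le_sum fun e _ => hyle e
  · rw [hsize]
    have := h.gain
    linarith
  · rw [hsize]
    have := h.near_optimal hqr x' hx'
    linarith

theorem count_le (h : PriceInvariant G L k q N y r x J) (hk : 0 < k) : J ≤ m * (r + 3) := by
  have hk' : (0 : ℝ) < k := by exact_mod_cast hk
  have hb1 : 1 < 1 + 1 / (k : ℝ) := by
    have : 0 < 1 / (k : ℝ) := by positivity
    linarith
  have h1 : ∏ e, y e ≤ ∏ _e : Fin m, (1 + 1 / (k : ℝ)) ^ (r + 3) :=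
    Finset.prod_le_prod (fun e _ => by linarith [h.one_le e]) fun e _ => h.le_pow e
  have h2 := h.count.trans h1
  rw [Finset.prod_const, Finset.card_univ, Fintype.card_fin, ← pow_mul] at h2
  have := (pow_le_pow_iff_right₀ hb1).1 h2
  rwa [mul_comm] at this

/-- When the estimate has been raised `N - 3` times, the scaled flow is feasible and the
potential bounds the maximum. -/
theorem isApproxMaxFlow (h : PriceInvariant G L k q N y r x J) {ε : ℝ} (hε : 0 < ε) (hε1 : ε < 1)
    (hkε : 4 ≤ k * ε) (hN : N = k * (q + k + 3)) (hr : r + 3 = N) :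
    G.IsApproxMaxFlow L (1 + ε) x := by
  have hk4 : (4 : ℝ) < k := by nlinarith
  have hk' : (0 : ℝ) < k := by linarith
  have hk : 5 ≤ k := by exact_mod_cast hk4
  have hb1 : 1 < 1 + 1 / (k : ℝ) := by
    have : 0 < 1 / (k : ℝ) := by positivity
    linarith
  have hNr : (N : ℝ) = k * (q + k + 3) := by exact_mod_cast hN
  have hrr : (r : ℝ) + 3 = N := by exact_mod_cast hr
  have hN0 : (0 : ℝ) < N := by rw [hNr]; positivity
  refine ⟨⟨h.nonneg, h.mem_boundedPaths, fun e => ?_⟩, fun x' hx' => ?_⟩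
  · have h1 := (h.load e).trans (h.le_pow e)
    rw [← Real.rpow_natCast, Real.rpow_le_rpow_left_iff hb1, hr, div_le_iff₀ (G.cap_pos e)] at h1
    have : edgeLoad x e ≤ G.cap e := by
      refine le_of_mul_le_mul_right ?_ hN0
      linarith
    exact this
  · have hqr : q ≤ r := by nlinarith
    have h1 := h.near_optimal hqr x' hx'
    have hF := flowSize_nonneg hx'.nonneg
    have hf := flowSize_nonneg h.nonneg
    have hW0 : 0 ≤ (∑ e, G.cap e * (y e - 1)) / (1 + 1 / (k : ℝ)) ^ r :=
      div_nonneg (Finset.sum_nonneg fun e _ =>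
        mul_nonneg (G.cap_pos e).le (by linarith [h.one_le e])) (by positivity)
    have h2 : 0 ≤ (k : ℝ) * L / (1 + 1 / (k : ℝ)) ^ r := by positivity
    -- `r - q - k = (k - 1) * (q + k + 3)`, while `N = k * (q + k + 3)`
    have h3 : 1 / k * flowSize x' * (((k : ℝ) - 1) * (q + k + 3)) ≤
        1 / k * (1 + 2 / k) * (k * (q + k + 3) * flowSize x) := by
      rw [← hNr]
      have : 1 / k * flowSize x' * (((k : ℝ) - 1) * (q + k + 3)) ≤
          1 / k * flowSize x' * ((r : ℝ) - q - k + k * L / (1 + 1 / (k : ℝ)) ^ r) := by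
        refine mul_le_mul_of_nonneg_left ?_ (mul_nonneg (by positivity) hF)
        nlinarith
      linarith
    have h4 : flowSize x' * (k - 1) ≤ (k + 2) * flowSize x := by
      have hB : (0 : ℝ) < (q + k + 3) / k := by positivity
      refine le_of_mul_le_mul_right ?_ hB
      calc _ = 1 / k * flowSize x' * (((k : ℝ) - 1) * (q + k + 3)) := by ring
        _ ≤ _ := h3
        _ = _ := by field_simp
    have h5 : (k : ℝ) + 2 ≤ (1 + ε) * (k - 1) := by nlinarith
    refine le_of_mul_le_mul_right (h4.trans ?_) (by linarith : (0 : ℝ) < k - 1)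
    nlinarith
end PriceInvariant

/-! ### Tables of largest slacks -/

/-- The first `κ` levels of the table `D`, and the part of level `κ` that comes from the edges
`0, …, i - 1`, are filled. For integer edge weights `w`, the entry `D κ v` is the largest slack
`L + 1 - ℓ` over the lengths `ℓ ≤ L` of the walks of weight exactly `κ` from `v` to the sink, or
`0` if there is no such walk, and `S κ v` is the first edge of a walk that attains it. -/
structure SlackTable {n m : ℕ} (G : Network n m) (L : ℕ) (w : Fin m → ℕ) (D S : ℕ → Fin n → ℕ)
    (κ i : ℕ) : Prop where
  sink : D 0 G.sink = L + 1
  eq_sink : ∀ v, 0 < D 0 v → v = G.sink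
  sound : ∀ κ' v, 0 < κ' → 0 < D κ' v →
    ∃ e : Fin m, S κ' v = e ∧ G.tail e = v ∧ w e ≤ κ' ∧
      D κ' v + G.len e = D (κ' - w e) (G.head e)
  complete : ∀ κ' (e : Fin m), w e ≤ κ' → (κ' < κ ∨ κ' = κ ∧ e < i) →
    D (κ' - w e) (G.head e) - G.len e ≤ D κ' (G.tail e)
  zero : ∀ κ' v, κ < κ' → D κ' v = 0

namespace SlackTable

variable {n m : ℕ} {G : Network n m} {L : ℕ} {w : Fin m → ℕ} {D S D' S' : ℕ → Fin n → ℕ}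
  {κ i : ℕ}

theorem init (hw : ∀ e, 0 < w e) (hD : ∀ κ v, D κ v = if κ = 0 ∧ v = G.sink then L + 1 else 0) :
    SlackTable G L w D S 0 i where
  sink := by simp [hD]
  eq_sink v hv := by
    by_contra h
    simp [hD, h] at hv
  sound κ' v hκ hv := by simp [hD, hκ.ne'] at hv
  complete κ' e he h := by
    have := hw e
    omega
  zero κ' v h := by
    have : κ' ≠ 0 := by omega
    simp [hD, this]

theorem next (h : SlackTable G L w D S κ m) : SlackTable G L w D S (κ + 1) 0 where
  sink := h.sink
  eq_sink := h.eq_sink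
  sound := h.sound
  complete κ' e he h' := by
    refine h.complete κ' e he ?_
    have := e.isLt
    omega
  zero κ' v h' := h.zero κ' v (by omega)

theorem relax_of_lt (h : SlackTable G L w D S κ i) {e : Fin m} (he : (e : ℕ) = i)
    (hw : ∀ e, 0 < w e) (hκ : 0 < κ) (hle : w e ≤ κ)
    (hlt : D κ (G.tail e) < D (κ - w e) (G.head e) - G.len e)
    (hD : ∀ κ' v, D' κ' v =
      if κ' = κ ∧ v = G.tail e then D (κ - w e) (G.head e) - G.len e else D κ' v)
    (hS : ∀ κ' v, S' κ' v = if κ' = κ ∧ v = G.tail e then (e : ℕ) else S κ' v) :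
    SlackTable G L w D' S' κ (i + 1) := by
  have hlow : ∀ κ' v, κ' < κ → D' κ' v = D κ' v := fun κ' v h' => by simp [hD, h'.ne]
  have hle' : ∀ v, D κ v ≤ D' κ v := fun v => by
    rw [hD]
    split_ifs with h'
    · rw [h'.2]; omega
    · exact le_rfl
  have hwe := hw e
  refine ⟨by rw [hlow _ _ hκ, h.sink], fun v hv => h.eq_sink v (by rwa [hlow _ _ hκ] at hv),
    fun κ' v h0 hv => ?_, fun κ' f hf hlt' => ?_, fun κ' v h' => by simp [hD, h'.ne', h.zero _ _ h']⟩
  · by_cases hc : κ' = κ ∧ v = G.tail e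
    · obtain ⟨rfl, rfl⟩ := hc
      refine ⟨e, by simp [hS], rfl, hle, ?_⟩
      rw [hlow (κ' - w e) _ (by omega), hD, if_pos ⟨rfl, rfl⟩]
      omega
    · have hv' : D' κ' v = D κ' v := by rw [hD, if_neg hc]
      obtain ⟨f, h1, h2, h3, h4⟩ := h.sound κ' v h0 (hv' ▸ hv)
      refine ⟨f, by rw [hS, if_neg hc, h1], h2, h3, ?_⟩
      have hf := hw f
      rw [hv', h4, hD, if_neg]
      rintro ⟨h5, -⟩
      rcases le_or_gt κ' κ with h6 | h6
      · omega
      · rw [h.zero κ' v h6] at hv'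
        omega
  · have hwf := hw f
    rcases hlt' with h1 | ⟨rfl, h1⟩
    · rw [hlow _ _ h1, hlow _ _ (by omega)]
      exact h.complete κ' f hf (Or.inl h1)
    · rw [hlow _ _ (by omega : κ' - w f < κ')]
      rcases Nat.lt_succ_iff_lt_or_eq.1 h1 with h2 | h2
      · exact (h.complete κ' f hf (Or.inr ⟨rfl, h2⟩)).trans (hle' _)
      · obtain rfl : f = e := Fin.ext (h2.trans he.symm)
        rw [hD κ', if_pos ⟨rfl, rfl⟩]

theorem relax_of_not_lt (h : SlackTable G L w D S κ i) {e : Fin m} (he : (e : ℕ) = i)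
    (hlt : w e ≤ κ → D (κ - w e) (G.head e) - G.len e ≤ D κ (G.tail e)) :
    SlackTable G L w D S κ (i + 1) where
  sink := h.sink
  eq_sink := h.eq_sink
  sound := h.sound
  complete κ' f hf h' := by
    rcases h' with h1 | ⟨rfl, h1⟩
    · exact h.complete κ' f hf (Or.inl h1)
    · rcases Nat.lt_succ_iff_lt_or_eq.1 h1 with h2 | h2
      · exact h.complete κ' f hf (Or.inr ⟨rfl, h2⟩)
      · obtain rfl : f = e := Fin.ext (h2.trans he.symm)
        exact hlt hf
  zero := h.zero

/-- The entries of a filled table bound the slack of every walk to the sink. -/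
theorem le_of_isWalk (h : SlackTable G L w D S κ m) {p : List (Fin m)} {v : Fin n}
    (hp : G.IsWalk v p G.sink) (hκ : (p.map w).sum ≤ κ) :
    L + 1 ≤ D (p.map w).sum v + (p.map G.len).sum := by
  induction p generalizing v with
  | nil =>
    obtain rfl : v = G.sink := hp
    simp [h.sink]
  | cons e p ih =>
    obtain ⟨rfl, hp⟩ := hp
    simp only [List.map_cons, List.sum_cons] at hκ ⊢
    have h1 := ih hp (by omega)
    have h2 := h.complete (w e + (p.map w).sum) e (by omega) (by have := e.isLt; omega)
    rw [Nat.add_sub_cancel_left] at h2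
    omega

/-- A bounded walk of minimum weight visits no vertex twice, since the weights are positive. -/
theorem isPath (h : SlackTable G L w D S κ m) (hw : ∀ e, 0 < w e)
    (hmin : ∀ κ' < κ, D κ' G.source = 0) {p : List (Fin m)}
    (hp : G.IsWalk G.source p G.sink) (hκ : (p.map w).sum = κ) (hL : (p.map G.len).sum ≤ L) :
    G.IsPath p := by
  refine ⟨hp, ?_⟩
  by_contra hn
  obtain ⟨c, q, hperm, hc, hq⟩ := Network.exists_shortcut hp hn
  have h1 : (p.map w).sum = (c.map w).sum + (q.map w).sum := by
    rw [(hperm.map w).sum_eq]; simp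
  have h2 : (p.map G.len).sum = (c.map G.len).sum + (q.map G.len).sum := by
    rw [(hperm.map G.len).sum_eq]; simp
  have h3 : 0 < (c.map w).sum := by
    obtain ⟨e, c', rfl⟩ := List.exists_cons_of_ne_nil hc
    have := hw e
    simp; omega
  have h4 := h.le_of_isWalk hq (by omega)
  rw [hmin _ (by omega)] at h4
  omega

theorem lt_weight_of_isPath (h : SlackTable G L w D S κ m)
    (hmin : ∀ κ' ≤ κ, D κ' G.source = 0) {p : List (Fin m)} (hp : p ∈ G.boundedPaths L) :
    κ < (p.map w).sum := by
  by_contra hn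
  have h1 := h.le_of_isWalk hp.1.1 (by omega)
  rw [hmin _ (by omega)] at h1
  have := hp.2
  omega

end SlackTable

/-! ### Integer weights -/

/-- The integer weights `w` arise from the edge prices `y` by dividing by `α / (k * n)` and rounding
up, where it does not matter which weight above `n * (k + 2)` an edge gets. -/
structure RoundedWeights {n m : ℕ} (k : ℕ) (α : ℝ) (y : Fin m → ℝ) (w : Fin m → ℕ) :
    Prop where
  pos : ∀ e, 0 < w e
  le : ∀ e, w e * α ≤ y e * (k * n) + α
  ge : ∀ e, w e ≤ n * (k + 2) → y e * (k * n) ≤ w e * α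

namespace RoundedWeights

variable {n m : ℕ} {G : Network n m} {k : ℕ} {α : ℝ} {y : Fin m → ℝ} {w : Fin m → ℕ}

theorem sum_le (h : RoundedWeights (n := n) k α y w) (p : List (Fin m)) :
    ((p.map w).sum : ℝ) * α ≤ (p.map y).sum * (k * n) + p.length * α := by
  induction p with
  | nil => simp
  | cons e p ih =>
    have := h.le e
    simp only [List.map_cons, List.sum_cons, List.length_cons, Nat.cast_add, Nat.cast_one]
    linarith

theorem le_sum (h : RoundedWeights (n := n) k α y w) {p : List (Fin m)}
    (hp : (p.map w).sum ≤ n * (k + 2)) :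
    (p.map y).sum * (k * n) ≤ (p.map w).sum * α := by
  induction p with
  | nil => simp
  | cons e p ih =>
    simp only [List.map_cons, List.sum_cons] at hp ⊢
    have h1 := ih (by omega)
    have h2 := h.ge e (by omega)
    rw [Nat.cast_add]
    linarith

/-- Paths of weight above the threshold `n * (k + 2)` have a price of at least `(1 + 1 / k) * α`. -/
theorem le_price (h : RoundedWeights (n := n) k α y w) (hk : 0 < k) (hα : 0 < α)
    {p : List (Fin m)} (hp : G.IsPath p) (hlt : n * (k + 2) < (p.map w).sum) :
    α * (1 + 1 / k) ≤ (p.map y).sum := by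
  have hk' : (0 : ℝ) < k := by exact_mod_cast hk
  have hn : (0 : ℝ) < n := by exact_mod_cast (Nat.zero_le _).trans_lt hp.length_lt
  have h1 := h.sum_le p
  have h2 : (n : ℝ) * (k + 2) ≤ (p.map w).sum := by exact_mod_cast hlt.le
  have h3 : (p.length : ℝ) ≤ n := by exact_mod_cast hp.length_lt.le
  have h4 : (n : ℝ) * (k + 2) * α ≤ (p.map y).sum * (k * n) + n * α :=
    (mul_le_mul_of_nonneg_right h2 hα.le).trans
      (h1.trans (by gcongr))
  refine le_of_mul_le_mul_right ?_ (by positivity : (0 : ℝ) < k * n)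
  calc α * (1 + 1 / k) * (k * n) = n * (k + 1) * α := by field_simp
    _ ≤ _ := by linarith

/-- Conversely, paths of weight at most the threshold are cheap enough for an augmentation. -/
theorem price_le (h : RoundedWeights (n := n) k α y w) (hk : 0 < k) (hn : 0 < n) (hα : 0 < α)
    {p : List (Fin m)} (hp : (p.map w).sum ≤ n * (k + 2)) :
    (p.map y).sum ≤ (1 + 2 / k) * α := by
  have hk' : (0 : ℝ) < k := by exact_mod_cast hk
  have hn' : (0 : ℝ) < n := by exact_mod_cast hn
  have h1 := h.le_sum hp
  have h2 : ((p.map w).sum : ℝ) ≤ n * (k + 2) := by exact_mod_cast hp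
  refine le_of_mul_le_mul_right ?_ (by positivity : (0 : ℝ) < k * n)
  calc _ ≤ _ := h1
    _ ≤ n * (k + 2) * α := by gcongr
    _ = _ := by field_simp

end RoundedWeights

/-! ### Executions with a time bound -/

namespace RealRAM

-- Arithmetic notation and numerals for expressions, and `;;` for sequencing.
instance : Add NatExpr := ⟨.add⟩
instance : Sub NatExpr := ⟨.sub⟩
instance : Mul NatExpr := ⟨.mul⟩
instance : Add RealExpr := ⟨.add⟩
instance : Mul RealExpr := ⟨.mul⟩
instance : Div RealExpr := ⟨.div⟩
instance (k : ℕ) : OfNat NatExpr k := ⟨.const k⟩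
instance (k : ℕ) : OfNat RealExpr k := ⟨.ofNat (.const k)⟩

infixr:60 " ;; " => Program.seq

section eval

variable (μ : Memory)

@[simp] theorem NatExpr.eval_add (e f : NatExpr) : (e + f).eval μ = e.eval μ + f.eval μ := rfl
@[simp] theorem NatExpr.eval_sub (e f : NatExpr) : (e - f).eval μ = e.eval μ - f.eval μ := rfl
@[simp] theorem NatExpr.eval_mul (e f : NatExpr) : (e * f).eval μ = e.eval μ * f.eval μ := rfl
@[simp] theorem NatExpr.eval_get (a : ℕ) (i : NatExpr) :
    (NatExpr.get a i).eval μ = μ.nat a (i.eval μ) := rfl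
@[simp] theorem NatExpr.eval_lit (k : ℕ) : (ofNat(k) : NatExpr).eval μ = OfNat.ofNat k := rfl
@[simp] theorem RealExpr.eval_add (e f : RealExpr) : (e + f).eval μ = e.eval μ + f.eval μ := rfl
@[simp] theorem RealExpr.eval_mul (e f : RealExpr) : (e * f).eval μ = e.eval μ * f.eval μ := rfl
@[simp] theorem RealExpr.eval_div (e f : RealExpr) : (e / f).eval μ = e.eval μ / f.eval μ := rfl
@[simp] theorem RealExpr.eval_get (a : ℕ) (i : NatExpr) :
    (RealExpr.get a i).eval μ = μ.real a (i.eval μ) := rfl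
@[simp] theorem RealExpr.eval_ofNat (e : NatExpr) : (RealExpr.ofNat e).eval μ = e.eval μ := rfl
@[simp] theorem RealExpr.eval_lit (k : ℕ) : (ofNat(k) : RealExpr).eval μ = (OfNat.ofNat k : ℕ) := rfl
@[simp] theorem Test.holds_natLe (e f : NatExpr) :
    (Test.natLe e f).Holds μ ↔ e.eval μ ≤ f.eval μ := Iff.rfl
@[simp] theorem Test.holds_realLe (e f : RealExpr) :
    (Test.realLe e f).Holds μ ↔ e.eval μ ≤ f.eval μ := Iff.rfl
@[simp] theorem Test.holds_neg (b : Test) : (Test.neg b).Holds μ ↔ ¬ b.Holds μ := Iff.rfl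
@[simp] theorem Test.holds_both (b c : Test) :
    (Test.both b c).Holds μ ↔ b.Holds μ ∧ c.Holds μ := Iff.rfl

@[simp] theorem Memory.setNat_nat (a i k b j : ℕ) :
    (μ.setNat a i k).nat b j = if b = a ∧ j = i then k else μ.nat b j := by
  by_cases hb : b = a
  · subst hb
    by_cases hj : j = i <;> simp [Memory.setNat, hj]
  · simp [Memory.setNat, hb]

@[simp] theorem Memory.setNat_real (a i k : ℕ) : (μ.setNat a i k).real = μ.real := rfl
@[simp] theorem Memory.setReal_nat (a i : ℕ) (r : ℝ) : (μ.setReal a i r).nat = μ.nat := rfl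

@[simp] theorem Memory.setReal_real (a i : ℕ) (r : ℝ) (b j : ℕ) :
    (μ.setReal a i r).real b j = if b = a ∧ j = i then r else μ.real b j := by
  by_cases hb : b = a
  · subst hb
    by_cases hj : j = i <;> simp [Memory.setReal, hj]
  · simp [Memory.setReal, hb]

end eval

/-- `P`, started on `μ`, halts within `T` steps in a memory that satisfies `Q`. -/
def Reach (P : Program) (μ : Memory) (T : ℕ) (Q : Memory → Prop) : Prop :=
  ∃ μ' T', Exec P μ μ' T' ∧ T' ≤ T ∧ Q μ'

theorem Reach.mono {P : Program} {μ : Memory} {T T' : ℕ} {Q Q' : Memory → Prop}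
    (h : Reach P μ T Q) (hT : T ≤ T') (hQ : ∀ μ', Q μ' → Q' μ') : Reach P μ T' Q' := by
  obtain ⟨μ', t, h1, h2, h3⟩ := h
  exact ⟨μ', t, h1, h2.trans hT, hQ _ h3⟩

theorem Reach.seq {P P' : Program} {μ : Memory} {T T' : ℕ} {Q Q' : Memory → Prop}
    (h : Reach P μ T Q) (h' : ∀ μ', Q μ' → Reach P' μ' T' Q') : Reach (P ;; P') μ (T + T') Q' := by
  obtain ⟨μ₁, t, h1, h2, h3⟩ := h
  obtain ⟨μ₂, t', h4, h5, h6⟩ := h' _ h3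
  exact ⟨μ₂, t + t', h1.seq h4, Nat.add_le_add h2 h5, h6⟩

theorem Reach.cond {b : Test} {P P' : Program} {μ : Memory} {T : ℕ} {Q : Memory → Prop}
    (h : b.Holds μ → Reach P μ T Q) (h' : ¬ b.Holds μ → Reach P' μ T Q) :
    Reach (.cond b P P') μ (b.cost + T) Q := by
  by_cases hb : b.Holds μ
  · obtain ⟨μ', t, h1, h2, h3⟩ := h hb
    exact ⟨μ', _, .condTrue hb h1, Nat.add_le_add_left h2 _, h3⟩
  · obtain ⟨μ', t, h1, h2, h3⟩ := h' hb
    exact ⟨μ', _, .condFalse hb h1, Nat.add_le_add_left h2 _, h3⟩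

/-- A loop whose invariant `I i` after `i` rounds admits another round only for `i < N`. -/
theorem Reach.loop {b : Test} {P : Program} {μ : Memory} {T N c : ℕ} (I : ℕ → Memory → Prop)
    (hc : b.cost ≤ c) (h0 : I 0 μ)
    (hstep : ∀ i μ, I i μ → b.Holds μ → i < N ∧ Reach P μ T (I (i + 1))) :
    Reach (.loop b P) μ (N * (c + T) + c) (fun μ' => ∃ i ≤ N, I i μ' ∧ ¬ b.Holds μ') := by
  have key : ∀ d i μ, i + d = N → I i μ →
      Reach (.loop b P) μ (d * (c + T) + c)
        (fun μ' => ∃ i ≤ N, I i μ' ∧ ¬ b.Holds μ') := by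
    intro d
    induction d with
    | zero =>
      intro i μ hi hI
      have hb : ¬ b.Holds μ := fun hb => by
        have := (hstep i μ hI hb).1
        omega
      exact ⟨μ, _, .loopDone hb, by omega, i, by omega, hI, hb⟩
    | succ d ih =>
      intro i μ hi hI
      by_cases hb : b.Holds μ
      · obtain ⟨-, μ', t, h1, h2, h3⟩ := hstep i μ hI hb
        obtain ⟨μ'', t', h4, h5, h6⟩ := ih (i + 1) μ' (by omega) h3
        refine ⟨μ'', _, .loopStep hb h1 h4, ?_, h6⟩
        rw [Nat.add_mul, one_mul]
        omega
      · exact ⟨μ, _, .loopDone hb, by omega, i, by omega, hI, hb⟩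
  exact key N 0 μ (by omega) h0

/-- The loop that runs `P` while the scalar `c` counts from `0` up to the bound. -/
def forLoop (c : ℕ) (bound : NatExpr) (P : Program) : Program :=
  .setNat c 0 0 ;;
    .loop (.natLe (.get c 0 + 1) bound) (P ;; .setNat c 0 (.get c 0 + 1))

theorem Reach.forLoop {c : ℕ} {bound : NatExpr} {P : Program} {μ : Memory} {T N : ℕ}
    (I : ℕ → Memory → Prop) (hc : bound.cost ≤ 6) (h0 : I 0 (μ.setNat c 0 0))
    (hbound : ∀ i μ, I i μ → bound.eval μ = N)
    (hstep : ∀ i μ, i < N → μ.nat c 0 = i → I i μ →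
      Reach P μ T (fun μ' => μ'.nat c 0 = i ∧ I (i + 1) (μ'.setNat c 0 (i + 1)))) :
    Reach (forLoop c bound P) μ ((N + 1) * (T + 20)) (I N) := by
  have h1 : Reach (.setNat c 0 0) μ 3 (fun μ' => μ'.nat c 0 = 0 ∧ I 0 μ') :=
    ⟨_, _, .setNat μ c 0 0, le_rfl, by simp, h0⟩
  have h2 : ∀ μ', μ'.nat c 0 = 0 ∧ I 0 μ' → _ := fun μ' hμ =>
    Reach.loop (b := .natLe (.get c 0 + 1) bound) (P := P ;; .setNat c 0 (.get c 0 + 1))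
      (T := T + 6) (N := N) (c := 11)
      (fun i μ => μ.nat c 0 = i ∧ I i μ) (by
        change 1 + 1 + 1 + 1 + bound.cost + 1 ≤ 11
        omega) hμ (fun i μ hI hb => by
        have hb' : μ.nat c 0 + 1 ≤ bound.eval μ := hb
        rw [hbound i μ hI.2, hI.1] at hb'
        refine ⟨hb', (hstep i μ hb' hI.1 hI.2).seq fun μ' hμ' => ?_⟩
        refine ⟨_, _, .setNat _ _ _ _, le_rfl, by simp [hμ'.1], ?_⟩
        simpa [hμ'.1] using hμ'.2)
  refine (h1.seq h2).mono ?_ ?_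
  · rw [Nat.add_mul]
    have : N * (11 + (T + 6)) ≤ N * (T + 20) := Nat.mul_le_mul_left _ (by omega)
    omega
  · rintro μ' ⟨i, hi, ⟨h3, h4⟩, h5⟩
    have h5' : ¬ μ'.nat c 0 + 1 ≤ bound.eval μ' := h5
    rw [hbound i μ' h4, h3] at h5'
    obtain rfl : i = N := by omega
    exact h4

/-- The weakest precondition of a program without loops (it fails for loops). -/
def Program.wp : Program → (Memory → Prop) → Memory → Prop
  | skip, Q, μ => Q μ
  | setNat a i e, Q, μ => Q (μ.setNat a (i.eval μ) (e.eval μ))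
  | setReal a i e, Q, μ => Q (μ.setReal a (i.eval μ) (e.eval μ))
  | seq P P', Q, μ => P.wp (P'.wp Q) μ
  | cond b P P', Q, μ => (b.Holds μ → P.wp Q μ) ∧ (¬ b.Holds μ → P'.wp Q μ)
  | loop _ _, _, _ => False

/-- An upper bound on the running time of a program without loops. -/
def Program.maxCost : Program → ℕ
  | skip => 1
  | setNat _ i e => i.cost + e.cost + 1
  | setReal _ i e => i.cost + e.cost + 1
  | seq P P' => P.maxCost + P'.maxCost
  | cond b P P' => b.cost + (P.maxCost + P'.maxCost)
  | loop _ _ => 0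

theorem Reach.of_wp {P : Program} {Q : Memory → Prop} {μ : Memory} (h : P.wp Q μ) {T : ℕ}
    (hT : P.maxCost ≤ T) : Reach P μ T Q := by
  refine Reach.mono (T := P.maxCost) ?_ hT fun _ => id
  clear hT
  induction P generalizing Q μ with
  | skip => exact ⟨_, _, .skip μ, le_rfl, h⟩
  | setNat a i e => exact ⟨_, _, .setNat μ a i e, le_rfl, h⟩
  | setReal a i e => exact ⟨_, _, .setReal μ a i e, le_rfl, h⟩
  | seq P P' ih ih' => exact (ih h).seq fun μ hμ => ih' hμ
  | cond b P P' ih ih' =>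
    exact Reach.cond (fun hb => (ih (h.1 hb)).mono (by omega) fun _ => id)
      (fun hb => (ih' (h.2 hb)).mono (by omega) fun _ => id)
  | loop b P ih => exact h.elim

/-- `μ'` differs from `μ` at most in the integer arrays listed in `A` and the real arrays listed
in `B`. -/
def SameExcept (A B : List ℕ) (μ μ' : Memory) : Prop :=
  (∀ a ∉ A, μ'.nat a = μ.nat a) ∧ ∀ b ∉ B, μ'.real b = μ.real b

namespace SameExcept

variable {A B A' B' : List ℕ} {μ μ₁ μ₂ : Memory}

theorem refl (A B : List ℕ) (μ : Memory) : SameExcept A B μ μ := ⟨fun _ _ => rfl, fun _ _ => rfl⟩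

theorem trans (h : SameExcept A B μ μ₁) (h' : SameExcept A B μ₁ μ₂) : SameExcept A B μ μ₂ :=
  ⟨fun a ha => (h'.1 a ha).trans (h.1 a ha), fun b hb => (h'.2 b hb).trans (h.2 b hb)⟩

theorem mono (h : SameExcept A B μ μ₁) (hA : A ⊆ A') (hB : B ⊆ B') : SameExcept A' B' μ μ₁ :=
  ⟨fun a ha => h.1 a fun h' => ha (hA h'), fun b hb => h.2 b fun h' => hb (hB h')⟩

theorem setNat (h : SameExcept A B μ μ₁) {a : ℕ} (ha : a ∈ A) (i k : ℕ) :
    SameExcept A B μ (μ₁.setNat a i k) := by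
  refine ⟨fun b hb => ?_, h.2⟩
  rw [← h.1 b hb]
  have : b ≠ a := fun h' => hb (h' ▸ ha)
  funext j
  simp [this]

theorem setReal (h : SameExcept A B μ μ₁) {a : ℕ} (ha : a ∈ B) (i : ℕ) (r : ℝ) :
    SameExcept A B μ (μ₁.setReal a i r) := by
  refine ⟨h.1, fun b hb => ?_⟩
  rw [← h.2 b hb]
  have : b ≠ a := fun h' => hb (h' ▸ ha)
  funext j
  simp [this]

end SameExcept

/-! ### The program -/

/-! The integer arrays from `8` on and the real arrays from `3` on are working memory. Scalars stand
at position `0` of an array of their own.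

* integer: `8` the step parameter `k`; `9` the level `q` with `L ≤ (1 + 1 / k) ^ q`; `10` the number
  `r` of raises of the distance estimate; `11` the scale `N`; `12` the edge counter; `13` the rounded
  weights; `14` and `15` the slack tables and the edges that attain their entries; `16` the position
  where the current tables start; `17` the current level of the table; `18` the largest level
  `n * (k + 2)`; `19` the current vertex of the trace; `20` the first free position of array `7`;
  `21` the position on the path; `22` the current edge of the trace.
* real: `3` the edge prices; `4` the distance estimate; `5` the smallest capacity on the traced
  path; `6` the powers of `1 + 1 / k`.
-/

/-- The position of the entry for the level `κ` and the vertex `v` in the current tables. -/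
def cell (κ v : NatExpr) : NatExpr := .get 16 0 + κ * .get 0 0 + v

@[simp] theorem eval_cell (μ : Memory) (κ v : NatExpr) :
    (cell κ v).eval μ = μ.nat 16 0 + κ.eval μ * μ.nat 0 0 + v.eval μ := rfl

/-- Find the least natural number `k` with `4 ≤ k * ε`. There is no rounding operation, but counting
up to `k = O(1 / ε)` is affordable. -/
def chooseStep : Program :=
  .loop (.neg (.realLe 4 (.ofNat (.get 8 0) * .get 0 0))) (.setNat 8 0 (.get 8 0 + 1))

/-- Find the least `q` with `L ≤ (1 + 1 / k) ^ q`. -/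
def findLevel : Program :=
  .setReal 6 0 1 ;;
  .loop (.neg (.realLe (.ofNat (.get 0 4)) (.get 6 0)))
    (.setReal 6 0 (.get 6 0 * (1 + 1 / .ofNat (.get 8 0))) ;; .setNat 9 0 (.get 9 0 + 1))

/-- Set all prices and the estimate to `1`, and the scale to `N = k * (q + k + 3)`. -/
def initPrices : Program :=
  .setNat 11 0 (.get 8 0 * (.get 9 0 + .get 8 0 + 3)) ;;
  .setNat 18 0 (.get 0 0 * (.get 8 0 + 2)) ;;
  .setReal 4 0 1 ;;
  forLoop 12 (.get 0 1) (.setReal 3 (.get 12 0) 1)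

/-- Divide the prices by `α / (k * n)`, where `α` is the estimate, and round up by counting; the
counting stops above the largest useful weight. -/
def roundWeights : Program :=
  forLoop 12 (.get 0 1)
    (.setNat 13 (.get 12 0) 1 ;;
      .loop (.both
          (.neg (.realLe (.get 3 (.get 12 0) * .ofNat (.get 8 0 * .get 0 0))
            (.ofNat (.get 13 (.get 12 0)) * .get 4 0)))
          (.natLe (.get 13 (.get 12 0)) (.get 18 0)))
        (.setNat 13 (.get 12 0) (.get 13 (.get 12 0) + 1)))

/-- Improve the entry of the tail of the current edge at the current level. The truncated subtraction
turns walks that are too long into the entry `0`, which stands for no walk. -/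
def relaxEdge : Program :=
  .cond (.both (.natLe (.get 13 (.get 12 0)) (.get 17 0))
      (.natLe (.get 14 (cell (.get 17 0) (.get 1 (.get 12 0))) + 1)
        (.get 14 (cell (.get 17 0 - .get 13 (.get 12 0)) (.get 2 (.get 12 0))) -
          .get 3 (.get 12 0))))
    (.setNat 14 (cell (.get 17 0) (.get 1 (.get 12 0)))
        (.get 14 (cell (.get 17 0 - .get 13 (.get 12 0)) (.get 2 (.get 12 0))) -
          .get 3 (.get 12 0)) ;;
      .setNat 15 (cell (.get 17 0) (.get 1 (.get 12 0))) (.get 12 0))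
    .skip

/-- Fill the levels of the table in increasing order, up to the first one at which the source has a
positive entry. -/
def fillTable : Program :=
  .setNat 17 0 0 ;;
  .setNat 14 (cell 0 (.get 0 3)) (.get 0 4 + 1) ;;
  .loop (.both (.natLe (.get 17 0 + 1) (.get 18 0))
      (.natLe (.get 14 (cell (.get 17 0) (.get 0 2))) 0))
    (.setNat 17 0 (.get 17 0 + 1) ;; forLoop 12 (.get 0 1) relaxEdge)

/-- Write down the path that attains the entry of the source, and find its smallest capacity. -/
def tracePath : Program :=
  .setNat 19 0 (.get 0 2) ;;
  .setNat 5 (.get 4 0) (.get 20 0) ;;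
  .loop (.natLe 1 (.get 17 0))
    (.setNat 22 0 (.get 15 (cell (.get 17 0) (.get 19 0))) ;;
      .cond (.both (.natLe (.get 5 (.get 4 0) + 1) (.get 20 0))
          (.realLe (.get 5 0) (.get 1 (.get 22 0))))
        .skip (.setReal 5 0 (.get 1 (.get 22 0))) ;;
      .setNat 7 (.get 20 0) (.get 22 0) ;;
      .setNat 20 0 (.get 20 0 + 1) ;;
      .setNat 17 0 (.get 17 0 - .get 13 (.get 22 0)) ;;
      .setNat 19 0 (.get 2 (.get 22 0))) ;;
  .setNat 6 (.get 4 0) (.get 20 0 - .get 5 (.get 4 0))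

/-- Send the smallest capacity, divided by `N`, along the traced path, and raise its prices. -/
def updatePrices : Program :=
  .setReal 2 (.get 4 0) (.get 5 0 / .ofNat (.get 11 0)) ;;
  forLoop 21 (.get 6 (.get 4 0))
    (.setReal 3 (.get 7 (.get 5 (.get 4 0) + .get 21 0))
      (.get 3 (.get 7 (.get 5 (.get 4 0) + .get 21 0)) *
        (1 + .get 5 0 / (.ofNat (.get 8 0) *
          .get 1 (.get 7 (.get 5 (.get 4 0) + .get 21 0)))))) ;;
  .setNat 4 0 (.get 4 0 + 1)

/-- Multiply the estimate by `1 + 1 / k`. -/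
def raiseEstimate : Program :=
  .setReal 4 0 (.get 4 0 * (1 + 1 / .ofNat (.get 8 0))) ;; .setNat 10 0 (.get 10 0 + 1)

/-- One augmentation or one raise of the estimate. Moving the start of the tables to fresh memory
replaces clearing them, which would take too long if `n` exceeds `m`. -/
def mainRound : Program :=
  roundWeights ;; fillTable ;;
  .cond (.natLe (.get 14 (cell (.get 17 0) (.get 0 2))) 0)
    raiseEstimate (tracePath ;; updatePrices) ;;
  .setNat 16 0 (.get 16 0 + .get 0 0 * (.get 18 0 + 1))

/-- The complete algorithm. -/
def approxMaxFlow : Program :=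
  chooseStep ;; findLevel ;; initPrices ;;
  .loop (.natLe (.get 10 0 + 4) (.get 11 0)) mainRound

/-! ### Correctness and running time of the parts -/

/-- The memory holds the instance and the parameters of the algorithm. -/
structure HoldsInstance {n m : ℕ} (G : Network n m) (L k N : ℕ) (μ : Memory) : Prop where
  vertices : μ.nat 0 0 = n
  edges : μ.nat 0 1 = m
  source : μ.nat 0 2 = G.source
  sink : μ.nat 0 3 = G.sink
  bound : μ.nat 0 4 = L
  tail : ∀ e : Fin m, μ.nat 1 e = G.tail e
  head : ∀ e : Fin m, μ.nat 2 e = G.head e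
  len : ∀ e : Fin m, μ.nat 3 e = G.len e
  cap : ∀ e : Fin m, μ.real 1 e = G.cap e
  step : μ.nat 8 0 = k
  scale : μ.nat 11 0 = N
  threshold : μ.nat 18 0 = n * (k + 2)

variable {n m : ℕ} {G : Network n m} {L k N : ℕ} {μ μ' : Memory}

theorem HoldsInstance.of_sameExcept (h : HoldsInstance G L k N μ) {A B : List ℕ}
    (hS : SameExcept A B μ μ') (hA : ∀ a ∈ [0, 1, 2, 3, 8, 11, 18], a ∉ A) (hB : 1 ∉ B) :
    HoldsInstance G L k N μ' := by
  have e0 := hS.1 0 (hA 0 (by simp))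
  have e1 := hS.1 1 (hA 1 (by simp))
  have e2 := hS.1 2 (hA 2 (by simp))
  have e3 := hS.1 3 (hA 3 (by simp))
  have e8 := hS.1 8 (hA 8 (by simp))
  have e11 := hS.1 11 (hA 11 (by simp))
  have e18 := hS.1 18 (hA 18 (by simp))
  have r1 := hS.2 1 hB
  constructor <;> simp only [e0, e1, e2, e3, e8, e11, e18, r1]
  exacts [h.vertices, h.edges, h.source, h.sink, h.bound, h.tail, h.head, h.len, h.cap, h.step,
    h.scale, h.threshold]

theorem reach_roundWeights (h : HoldsInstance G L k N μ) {y : Fin m → ℝ} {α : ℝ}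
    (hy : ∀ e : Fin m, μ.real 3 e = y e) (hy0 : ∀ e, 0 < y e) (hα : μ.real 4 0 = α) :
    Reach roundWeights μ ((m + 1) * (60 * (n * (k + 2)) + 100)) (fun μ' =>
      SameExcept [12, 13] [] μ μ' ∧
        ∃ w : Fin m → ℕ, RoundedWeights (n := n) k α y w ∧ ∀ e : Fin m, μ'.nat 13 e = w e) := by
  -- what the counter `W` of the edge `e` must satisfy after its loop
  set good : Fin m → ℕ → Prop := fun e W => 0 < W ∧ W * α ≤ y e * (k * n) + α ∧
    (W ≤ n * (k + 2) → y e * (k * n) ≤ W * α) with hgood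
  refine (Reach.forLoop (N := m) (T := 60 * (n * (k + 2)) + 50) (fun i μ' =>
    SameExcept [12, 13] [] μ μ' ∧ ∀ e : Fin m, e < i → good e (μ'.nat 13 e))
    (by decide) ?_ ?_ ?_).mono (Nat.mul_le_mul_left _ (by omega)) ?_
  · exact ⟨(SameExcept.refl _ _ _).setNat (by simp) _ _, by simp⟩
  · rintro i μ' ⟨hS, -⟩
    exact (h.of_sameExcept hS (by decide) (by decide)).edges
  · rintro i μ₁ hi hc ⟨hS, hw⟩
    have h1 := h.of_sameExcept hS (by decide) (by decide)
    have hstart : Reach (.setNat 13 (.get 12 0) 1) μ₁ 10 (fun μ₂ =>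
        (SameExcept [12, 13] [] μ μ₂ ∧ ∀ e : Fin m, e < i → good e (μ₂.nat 13 e)) ∧
        μ₂.nat 12 0 = i ∧ μ₂.nat 13 i = 1) := by
      refine Reach.of_wp ?_ (by decide)
      simp only [Program.wp]
      refine ⟨⟨hS.setNat (by simp) _ _, fun e he => ?_⟩, ?_, ?_⟩
      · simpa [hc, he.ne] using hw e he
      · simpa using hc
      · simp [hc]
    refine (hstart.seq (T' := 60 * (n * (k + 2)) + 40) fun μ₂ hμ₂ => ?_).mono (by omega)
      fun _ => id
    refine (Reach.loop (c := 30) (T := 15) (N := n * (k + 2)) (fun j μ₃ =>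
      (SameExcept [12, 13] [] μ μ₃ ∧ ∀ e : Fin m, e < i → good e (μ₃.nat 13 e)) ∧
        μ₃.nat 12 0 = i ∧ μ₃.nat 13 i = j + 1 ∧ j * α ≤ y ⟨i, hi⟩ * (k * n))
      (by decide) ?_ ?_).mono (by omega) ?_
    · refine ⟨hμ₂.1, hμ₂.2.1, by simp [hμ₂.2.2], ?_⟩
      have := hy0 ⟨i, hi⟩
      simp only [Nat.cast_zero, zero_mul]
      positivity
    · rintro j μ₃ ⟨⟨hS₃, hw₃⟩, hc₃, hW, hj⟩ hb
      have h3 := h.of_sameExcept hS₃ (by decide) (by decide)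
      have hy3 : μ₃.real 3 i = y ⟨i, hi⟩ := by rw [hS₃.2 3 (by decide)]; exact hy ⟨i, hi⟩
      have hα3 : μ₃.real 4 0 = α := by rw [hS₃.2 4 (by decide)]; exact hα
      simp [hc₃, hW, hy3, hα3, h3.step, h3.vertices, h3.threshold] at hb
      refine ⟨by omega, Reach.of_wp ?_ (by decide)⟩
      simp only [Program.wp]
      refine ⟨⟨hS₃.setNat (by simp) _ _, fun e he => ?_⟩, ?_, ?_, ?_⟩
      · simpa [hc₃, he.ne] using hw₃ e he
      · simpa using hc₃
      · simp [hc₃, hW]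
      · push_cast
        linarith [hb.1]
    · rintro μ₃ ⟨j, -, ⟨⟨hS₃, hw₃⟩, hc₃, hW, hj⟩, hb⟩
      have h3 := h.of_sameExcept hS₃ (by decide) (by decide)
      have hy3 : μ₃.real 3 i = y ⟨i, hi⟩ := by rw [hS₃.2 3 (by decide)]; exact hy ⟨i, hi⟩
      have hα3 : μ₃.real 4 0 = α := by rw [hS₃.2 4 (by decide)]; exact hα
      simp [hc₃, hW, hy3, hα3, h3.step, h3.vertices, h3.threshold] at hb
      refine ⟨hc₃, hS₃.setNat (by simp) _ _, fun e he => ?_⟩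
      rcases Nat.lt_succ_iff_lt_or_eq.1 he with he | he
      · simpa using hw₃ e he
      · obtain rfl : e = ⟨i, hi⟩ := Fin.ext he
        simp only [hgood, Memory.setNat_nat, hW]
        refine ⟨by simp, ?_, fun hle => ?_⟩
        · simp; linarith
        · simp at hle ⊢
          by_contra hcon
          have := hb (not_le.1 hcon)
          omega
  · rintro μ' ⟨hS, hw⟩
    exact ⟨hS, fun e => μ'.nat 13 e, ⟨fun e => (hw e e.isLt).1, fun e => (hw e e.isLt).2.1,
      fun e => (hw e e.isLt).2.2⟩, fun _ => rfl⟩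

theorem cell_inj {n b κ κ' : ℕ} {v v' : Fin n} :
    b + κ * n + v = b + κ' * n + v' ↔ κ = κ' ∧ v = v' := by
  constructor
  · intro h
    have h' : (v : ℕ) + n * κ = v' + n * κ' := by rw [mul_comm n, mul_comm n]; omega
    have hn : 0 < n := v.pos
    have h1 := congrArg (· / n) h'
    have h2 := congrArg (· % n) h'
    simp only [Nat.add_mul_div_left _ _ hn, Nat.div_eq_of_lt v.isLt, Nat.div_eq_of_lt v'.isLt,
      zero_add, Nat.add_mul_mod_self_left, Nat.mod_eq_of_lt v.isLt,
      Nat.mod_eq_of_lt v'.isLt] at h1 h2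
    exact ⟨h1, Fin.ext h2⟩
  · rintro ⟨rfl, rfl⟩
    rfl

/-- The arrays `14` and `15` hold slack tables that start at position `b`. -/
def HoldsTable (G : Network n m) (L : ℕ) (w : Fin m → ℕ) (b κ i : ℕ) (μ : Memory) : Prop :=
  SlackTable G L w (fun κ' v => μ.nat 14 (b + κ' * n + v)) (fun κ' v => μ.nat 15 (b + κ' * n + v))
    κ i

theorem reach_relaxEdge (h : HoldsInstance G L k N μ) {w : Fin m → ℕ}
    (hw : ∀ e : Fin m, μ.nat 13 e = w e) (hw0 : ∀ e, 0 < w e) {b κ i : ℕ} (hb : μ.nat 16 0 = b)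
    (hκ : μ.nat 17 0 = κ) (hκ0 : 0 < κ) (hi : i < m) (hc : μ.nat 12 0 = i)
    (ht : HoldsTable G L w b κ i μ) (hs : ∀ κ' < κ, μ.nat 14 (b + κ' * n + G.source) = 0) :
    Reach relaxEdge μ 150 (fun μ' => SameExcept [14, 15] [] μ μ' ∧
      HoldsTable G L w b κ (i + 1) μ' ∧ ∀ κ' < κ, μ'.nat 14 (b + κ' * n + G.source) = 0) := by
  obtain ⟨e, he⟩ : ∃ e : Fin m, (e : ℕ) = i := ⟨⟨i, hi⟩, rfl⟩
  rw [← he] at hc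
  refine Reach.of_wp ?_ (by decide)
  simp only [Program.wp, relaxEdge]
  refine ⟨fun hle => ?_, fun hle => ?_⟩
  · simp [hc, hw, hκ, hb, h.vertices, h.tail, h.head, h.len] at hle
    refine ⟨((SameExcept.refl _ _ _).setNat (by simp) _ _).setNat (by simp) _ _, ?_, ?_⟩
    · refine ht.relax_of_lt he hw0 hκ0 hle.1 hle.2 (fun κ' v => ?_) fun κ' v => ?_
      · simp [hc, hw, hκ, hb, h.vertices, h.tail, h.head, h.len, cell_inj]
      · simp [hc, hw, hκ, hb, h.vertices, h.tail, cell_inj]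
    · intro κ' hκ'
      simpa [hc, hw, hκ, hb, h.vertices, h.tail, h.head, h.len, cell_inj, hκ'.ne] using hs κ' hκ'
  · simp [hc, hw, hκ, hb, h.vertices, h.tail, h.head, h.len] at hle
    exact ⟨SameExcept.refl _ _ _, 
      ht.relax_of_not_lt he fun h' => Nat.sub_le_iff_le_add.2 (hle h'), hs⟩

theorem reach_fillTable (h : HoldsInstance G L k N μ) {w : Fin m → ℕ}
    (hw : ∀ e : Fin m, μ.nat 13 e = w e) (hw0 : ∀ e, 0 < w e) {b : ℕ} (hb : μ.nat 16 0 = b)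
    (hfree : ∀ j, b ≤ j → μ.nat 14 j = 0) :
    Reach fillTable μ (n * (k + 2) * ((m + 1) * 170 + 50) + 60) (fun μ' =>
      SameExcept [12, 14, 15, 17] [] μ μ' ∧ ∃ κ ≤ n * (k + 2), μ'.nat 17 0 = κ ∧
        HoldsTable G L w b κ m μ' ∧ (∀ κ' < κ, μ'.nat 14 (b + κ' * n + G.source) = 0) ∧
        (κ < n * (k + 2) → 0 < μ'.nat 14 (b + κ * n + G.source))) := by
  have hinit : Reach (.setNat 17 0 0 ;; .setNat 14 (cell 0 (.get 0 3)) (.get 0 4 + 1)) μ 20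
      (fun μ₁ => SameExcept [12, 14, 15, 17] [] μ μ₁ ∧ μ₁.nat 17 0 = 0 ∧
        HoldsTable G L w b 0 m μ₁ ∧ ∀ κ' < 0, μ₁.nat 14 (b + κ' * n + G.source) = 0) := by
    refine Reach.of_wp ?_ (by decide)
    simp only [Program.wp]
    refine ⟨((SameExcept.refl _ _ _).setNat (by simp) _ _).setNat (by simp) _ _, by simp, ?_,
      by simp⟩
    refine SlackTable.init hw0 fun κ v => ?_
    have h0 := cell_inj (n := n) (b := b) (κ := κ) (κ' := 0) (v := v) (v' := G.sink)
    rw [zero_mul, add_zero] at h0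
    simp [h.sink, h.bound, hb, h0]
    split_ifs
    · rfl
    · exact hfree _ (by omega)
  obtain ⟨μ₁, t, hx, ht, hS₁, hκ₁, htab, hs⟩ := hinit
  have hloop := Reach.loop (b := .both (.natLe (.get 17 0 + 1) (.get 18 0))
      (.natLe (.get 14 (cell (.get 17 0) (.get 0 2))) 0))
    (P := .setNat 17 0 (.get 17 0 + 1) ;; forLoop 12 (.get 0 1) relaxEdge)
    (μ := μ₁) (c := 30) (T := (m + 1) * 170 + 20) (N := n * (k + 2))
    (fun j μ₂ => SameExcept [12, 14, 15, 17] [] μ μ₂ ∧ μ₂.nat 17 0 = j ∧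
        HoldsTable G L w b j m μ₂ ∧ ∀ κ' < j, μ₂.nat 14 (b + κ' * n + G.source) = 0)
    (by decide) ⟨hS₁, hκ₁, htab, hs⟩ (by
      rintro j μ₂ ⟨hS₂, hκ₂, htab₂, hs₂⟩ hb₂
      have h2 := h.of_sameExcept hS₂ (by decide) (by decide)
      have hbase : μ₂.nat 16 0 = b := by rw [hS₂.1 16 (by decide), hb]
      simp [hκ₂, h2.threshold, hbase, h2.vertices, h2.source] at hb₂
      refine ⟨hb₂.1, ?_⟩
      have hset : Reach (.setNat 17 0 (.get 17 0 + 1)) μ₂ 10 (fun μ₃ =>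
          SameExcept [12, 14, 15, 17] [] μ μ₃ ∧ μ₃.nat 17 0 = j + 1 ∧
            HoldsTable G L w b (j + 1) 0 μ₃ ∧
            ∀ κ' < j + 1, μ₃.nat 14 (b + κ' * n + G.source) = 0) := by
        refine Reach.of_wp ?_ (by decide)
        simp only [Program.wp]
        refine ⟨hS₂.setNat (by simp) _ _, by simp [hκ₂], ?_, fun κ' hκ' => ?_⟩
        · have := htab₂.next
          simpa [HoldsTable] using this
        · rcases Nat.lt_succ_iff_lt_or_eq.1 hκ' with h' | rfl
          · simpa using hs₂ κ' h'
          · simpa using hb₂.2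
      refine (hset.seq fun μ₃ h₃ => Reach.forLoop (N := m) (T := 150) (fun i μ₄ =>
          SameExcept [12, 14, 15, 17] [] μ μ₄ ∧ μ₄.nat 17 0 = j + 1 ∧
            HoldsTable G L w b (j + 1) i μ₄ ∧
            ∀ κ' < j + 1, μ₄.nat 14 (b + κ' * n + G.source) = 0)
        (by decide) ?_ ?_ ?_).mono (by omega) fun _ => id
      · obtain ⟨hS₃, hκ₃, htab₃, hs₃⟩ := h₃
        exact ⟨hS₃.setNat (by simp) _ _, by simpa using hκ₃, by simpa [HoldsTable] using htab₃,
          by simpa using hs₃⟩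
      · rintro i μ₄ ⟨hS₄, -⟩
        exact (h.of_sameExcept hS₄ (by decide) (by decide)).edges
      · rintro i μ₄ hi hc ⟨hS₄, hκ₄, htab₄, hs₄⟩
        have h4 := h.of_sameExcept hS₄ (by decide) (by decide)
        refine (reach_relaxEdge h4 (fun e => by rw [hS₄.1 13 (by decide), hw]) hw0
          (by rw [hS₄.1 16 (by decide), hb]) hκ₄ (by omega) hi hc htab₄ hs₄).mono le_rfl ?_
        rintro μ₅ ⟨hS₅, htab₅, hs₅⟩
        refine ⟨by rw [hS₅.1 12 (by decide), hc],
          (hS₄.trans (hS₅.mono (by decide) (by decide))).setNat (by simp) _ _, ?_, ?_, ?_⟩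
        · simp [hS₅.1 17 (by decide), hκ₄]
        · simpa [HoldsTable] using htab₅
        · simpa using hs₅)
  obtain ⟨μ₂, t₂, hx₂, ht₂, j, hj, ⟨hS₂, hκ₂, htab₂, hs₂⟩, hb₂⟩ := hloop
  have h2 := h.of_sameExcept hS₂ (by decide) (by decide)
  have hbase : μ₂.nat 16 0 = b := by rw [hS₂.1 16 (by decide), hb]
  simp [hκ₂, h2.threshold, hbase, h2.vertices, h2.source] at hb₂
  cases hx with
  | seq hx hx' =>
    refine ⟨μ₂, _, hx.seq (hx'.seq hx₂), ?_, hS₂, j, hj, hκ₂, htab₂, hs₂, fun hlt =>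
      Nat.pos_of_ne_zero (hb₂ hlt)⟩
    have : n * (k + 2) * (30 + ((m + 1) * 170 + 20)) = n * (k + 2) * ((m + 1) * 170 + 50) := by ring
    omega

/-- Above the filled levels, the array that holds the table is still zero. -/
theorem HoldsTable.eq_zero {w : Fin m → ℕ} {b κ i K : ℕ} (h : HoldsTable G L w b κ i μ)
    (hκ : κ ≤ K) {j : ℕ} (hj : b + n * (K + 1) ≤ j) : μ.nat 14 j = 0 := by
  have hn : 0 < n := G.source.pos
  have h1 := h.zero ((j - b) / n) ⟨(j - b) % n, Nat.mod_lt _ hn⟩ (by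
    rw [← Nat.succ_le_iff, Nat.le_div_iff_mul_le hn]
    have : κ.succ * n ≤ n * (K + 1) := by
      rw [mul_comm]
      exact Nat.mul_le_mul_left _ (by omega)
    omega)
  have h2 : b + (j - b) / n * n + (j - b) % n = j := by
    have := Nat.div_add_mod' (j - b) n
    omega
  simpa [h2] using h1

/-- The edges of `p` stand in the integer array `7` from position `a` on. -/
def HoldsPath (p : List (Fin m)) (a : ℕ) (μ : Memory) : Prop :=
  p.map (fun e : Fin m => (e : ℕ)) = (List.range p.length).map fun i => μ.nat 7 (a + i)

theorem HoldsPath.congr {p : List (Fin m)} {a : ℕ} (h : HoldsPath p a μ)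
    (h' : ∀ i < p.length, μ'.nat 7 (a + i) = μ.nat 7 (a + i)) : HoldsPath p a μ' := by
  rw [HoldsPath, h]
  exact List.map_congr_left fun i hi => (h' i (List.mem_range.1 hi)).symm

theorem HoldsPath.concat {p : List (Fin m)} {a : ℕ} (h : HoldsPath p a μ) {e : Fin m}
    (he : μ.nat 7 (a + p.length) = e) : HoldsPath (p ++ [e]) a μ := by
  simp only [HoldsPath] at h ⊢
  simp [List.range_succ, h, he]

theorem HoldsPath.getElem {p : List (Fin m)} {a : ℕ} (h : HoldsPath p a μ) {i : ℕ}
    (hi : i < p.length) : μ.nat 7 (a + i) = p[i] := by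
  have h1 := congrArg (·[i]?) (h : _ = _)
  simp [hi] at h1
  exact h1.symm

theorem reach_tracePath (h : HoldsInstance G L k N μ) {w : Fin m → ℕ}
    (hw : ∀ e : Fin m, μ.nat 13 e = w e) (hw0 : ∀ e, 0 < w e) {b κ : ℕ} (hb : μ.nat 16 0 = b)
    (hκ : μ.nat 17 0 = κ) (ht : HoldsTable G L w b κ m μ)
    (hs : ∀ κ' < κ, μ.nat 14 (b + κ' * n + G.source) = 0)
    (hpos : 0 < μ.nat 14 (b + κ * n + G.source)) {J a : ℕ} (hJ : μ.nat 4 0 = J)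
    (ha : μ.nat 20 0 = a) :
    Reach tracePath μ (κ * 150 + 100) (fun μ' =>
      SameExcept [5, 6, 7, 17, 19, 20, 22] [5] μ μ' ∧
      ∃ p : List (Fin m), p ∈ G.boundedPaths L ∧ (p.map w).sum = κ ∧ HoldsPath p a μ' ∧
        μ'.nat 5 J = a ∧ μ'.nat 6 J = p.length ∧ μ'.nat 20 0 = a + p.length ∧
        (∀ j, j ≠ J → μ'.nat 5 j = μ.nat 5 j) ∧ (∀ j, j ≠ J → μ'.nat 6 j = μ.nat 6 j) ∧
        (∀ i < a, μ'.nat 7 i = μ.nat 7 i) ∧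
        (∀ e ∈ p, μ'.real 5 0 ≤ G.cap e) ∧ ∃ e ∈ p, μ'.real 5 0 = G.cap e) := by
  -- after tracing a walk `p` to `v`, the slack still available at `v` accounts for the length of `p`
  set I : ℕ → Memory → Prop := fun j μ' =>
    (SameExcept [5, 6, 7, 17, 19, 20, 22] [5] μ μ' ∧ μ'.nat 5 J = a ∧
      (∀ j, j ≠ J → μ'.nat 5 j = μ.nat 5 j) ∧ (∀ j, j ≠ J → μ'.nat 6 j = μ.nat 6 j) ∧
      ∀ i < a, μ'.nat 7 i = μ.nat 7 i) ∧
    ∃ (p : List (Fin m)) (v : Fin n) (κ' : ℕ), p.length = j ∧ μ'.nat 17 0 = κ' ∧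
      μ'.nat 19 0 = v ∧ μ'.nat 20 0 = a + p.length ∧ HoldsPath p a μ' ∧
      G.IsWalk G.source p v ∧ (p.map w).sum + κ' = κ ∧
      μ.nat 14 (b + κ * n + G.source) + (p.map G.len).sum = μ.nat 14 (b + κ' * n + v) ∧
      (∀ e ∈ p, μ'.real 5 0 ≤ G.cap e) ∧ (p ≠ [] → ∃ e ∈ p, μ'.real 5 0 = G.cap e) with hI
  have hinit : Reach (.setNat 19 0 (.get 0 2) ;; .setNat 5 (.get 4 0) (.get 20 0)) μ 20 (I 0) := by
    refine Reach.of_wp ?_ (by decide)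
    simp only [Program.wp]
    refine ⟨⟨((SameExcept.refl _ _ _).setNat (by simp) _ _).setNat (by simp) _ _, ?_, ?_, ?_, ?_⟩,
      [], G.source, κ, rfl, ?_, ?_, ?_, ?_, rfl, ?_, ?_, ?_, ?_⟩
    · simp [hJ, ha]
    · intro j hj
      simp [hJ, hj]
    · simp
    · simp
    · simp [hκ]
    · simp [h.source]
    · simp [ha]
    · simp [HoldsPath]
    all_goals simp
  have hbody : ∀ j μ₁, I j μ₁ → (Test.natLe 1 (.get 17 0)).Holds μ₁ → j < κ ∧
      Reach (.setNat 22 0 (.get 15 (cell (.get 17 0) (.get 19 0))) ;;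
      .cond (.both (.natLe (.get 5 (.get 4 0) + 1) (.get 20 0))
          (.realLe (.get 5 0) (.get 1 (.get 22 0))))
        .skip (.setReal 5 0 (.get 1 (.get 22 0))) ;;
      .setNat 7 (.get 20 0) (.get 22 0) ;;
      .setNat 20 0 (.get 20 0 + 1) ;;
      .setNat 17 0 (.get 17 0 - .get 13 (.get 22 0)) ;;
      .setNat 19 0 (.get 2 (.get 22 0))) μ₁ 120 (I (j + 1)) := by
    rintro j μ₁ ⟨⟨hS, h5, h5', h6, h7⟩, p, v, κ', rfl, hκ', hv, hend, hp, hwalk, hsum, hslack, hu,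
      hu'⟩ hb₁
    have hpos' : 0 < κ' := by simpa [hκ', Nat.succ_le_iff] using hb₁
    have hlen := length_le_sum_map hw0 p
    refine ⟨by omega, ?_⟩
    obtain ⟨e, he, htail, hwe, hD⟩ := ht.sound κ' v hpos' (by omega)
    have h1 := h.of_sameExcept hS (by decide) (by decide)
    have e4 : μ₁.nat 4 0 = J := by rw [hS.1 4 (by decide), hJ]
    have e15 : μ₁.nat 15 (b + κ' * n + v) = e := by rw [hS.1 15 (by decide)]; exact he
    have e16 : μ₁.nat 16 0 = b := by rw [hS.1 16 (by decide), hb]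
    have e13 : μ₁.nat 13 e = w e := by rw [hS.1 13 (by decide), hw]
    have hmid : Reach (.setNat 22 0 (.get 15 (cell (.get 17 0) (.get 19 0))) ;;
        .cond (.both (.natLe (.get 5 (.get 4 0) + 1) (.get 20 0))
            (.realLe (.get 5 0) (.get 1 (.get 22 0))))
          .skip (.setReal 5 0 (.get 1 (.get 22 0)))) μ₁ 50 (fun μ₂ =>
        SameExcept [22] [5] μ₁ μ₂ ∧ μ₂.nat 22 0 = e ∧
          (∀ f ∈ p ++ [e], μ₂.real 5 0 ≤ G.cap f) ∧ ∃ f ∈ p ++ [e], μ₂.real 5 0 = G.cap f) := by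
      refine Reach.of_wp ?_ (by decide)
      simp only [Program.wp]
      refine ⟨fun hle => ?_, fun hle => ?_⟩
      · simp [e4, e15, e16, hκ', hv, h1.vertices, h5, hend, h1.cap] at hle
        have hne : p ≠ [] := List.length_pos_iff.1 hle.1
        obtain ⟨f, hf, hf'⟩ := hu' hne
        refine ⟨(SameExcept.refl _ _ _).setNat (by simp) _ _, ?_, fun f hf => ?_, f, ?_, ?_⟩
        · simp [e15, e16, hκ', hv, h1.vertices]
        · rcases List.mem_append.1 hf with hf | hf
          · simpa using hu f hf
          · obtain rfl := List.mem_singleton.1 hf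
            simpa using hle.2
        · simp [hf]
        · simpa using hf'
      · simp [e4, e15, e16, hκ', hv, h1.vertices, h5, hend, h1.cap] at hle
        refine ⟨((SameExcept.refl _ _ _).setNat (by simp) _ _).setReal (by simp) _ _, ?_,
          fun f hf => ?_, e, by simp, ?_⟩
        · simp [e15, e16, hκ', hv, h1.vertices]
        · simp [e15, e16, hκ', hv, h1.vertices, h1.cap]
          rcases List.mem_append.1 hf with hf | hf
          · exact (hle (List.length_pos_of_mem hf)).le.trans (hu f hf)
          · rw [List.mem_singleton.1 hf]
        · simp [e15, e16, hκ', hv, h1.vertices, h1.cap]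
    obtain ⟨μ₂, t, hx, htime, hS₂, h22, hu₂, hu₂'⟩ := hmid
    have hS' : SameExcept [5, 6, 7, 17, 19, 20, 22] [5] μ μ₂ :=
      hS.trans (hS₂.mono (by decide) (by decide))
    have h2 := h.of_sameExcept hS' (by decide) (by decide)
    have g13 : μ₂.nat 13 e = w e := by rw [hS₂.1 13 (by decide), e13]
    have g17 : μ₂.nat 17 0 = κ' := by rw [hS₂.1 17 (by decide), hκ']
    have g20 : μ₂.nat 20 0 = a + p.length := by rw [hS₂.1 20 (by decide), hend]
    have g5 := hS₂.1 5 (by decide)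
    have g6 := hS₂.1 6 (by decide)
    have g7 := hS₂.1 7 (by decide)
    have hrest : Reach (.setNat 7 (.get 20 0) (.get 22 0) ;;
      .setNat 20 0 (.get 20 0 + 1) ;;
      .setNat 17 0 (.get 17 0 - .get 13 (.get 22 0)) ;;
      .setNat 19 0 (.get 2 (.get 22 0))) μ₂ 50 (I (p.length + 1)) := by
      refine Reach.of_wp ?_ (by decide)
      simp only [Program.wp]
      refine ⟨⟨(((hS'.setNat (by simp) _ _).setNat (by simp) _ _).setNat (by simp) _ _).setNat
        (by simp) _ _, ?_, ?_, ?_, ?_⟩, p ++ [e], G.head e, κ' - w e, by simp, ?_, ?_, ?_, ?_,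
        Network.isWalk_concat hwalk htail rfl, ?_, ?_, ?_, fun _ => ?_⟩
      · simp [g5, h5]
      · intro j hj
        simp [g5, h5' j hj]
      · intro j hj
        simp [g6, h6 j hj]
      · intro i hi
        have : i ≠ a + p.length := by omega
        simp [g7, g20, this, h7 i hi]
      · simp [h22, g13, g17]
      · simp [h22, h2.head]
      · simp [g20, add_assoc]
      · refine (hp.congr fun i hi => ?_).concat ?_
        · simp [g7, g20, hi.ne]
        · simp [g20, h22]
      · simp; omega
      · simp only [List.map_append, List.sum_append, List.map_cons, List.map_nil, List.sum_cons,
          List.sum_nil] at hD ⊢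
        omega
      · simpa using hu₂
      · simpa using hu₂'
    obtain ⟨μ₃, t₃, hx₃, ht₃, hI₃⟩ := hrest
    cases hx with
    | seq hx hx' => exact ⟨μ₃, _, hx.seq (hx'.seq hx₃), by omega, hI₃⟩
  obtain ⟨μ₁, t, hx, ht₁, hI₁⟩ := hinit
  obtain ⟨μ₂, t₂, hx₂, ht₂, j, hj, ⟨⟨hS, h5, h5', h6, h7⟩, p, v, κ', rfl, hκ', hv, hend, hp, hwalk,
    hsum, hslack, hu, hu'⟩, hb₂⟩ := Reach.loop (c := 10) (N := κ) I (by decide) hI₁ hbody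
  have hb₂' : ¬ 1 ≤ μ₂.nat 17 0 := hb₂
  obtain rfl : κ' = 0 := by omega
  have hv' : v = G.sink := ht.eq_sink v (by omega)
  have hsink : μ.nat 14 (b + 0 * n + v) = L + 1 := by rw [hv']; exact ht.sink
  have hL : (p.map G.len).sum ≤ L := by omega
  have hpath : G.IsPath p := ht.isPath hw0 hs (hv' ▸ hwalk) (by omega) hL
  have e4 : μ₂.nat 4 0 = J := by rw [hS.1 4 (by decide), hJ]
  cases hx with
  | seq hx hx' =>
    refine ⟨_, _, hx.seq (hx'.seq (hx₂.seq (.setNat _ _ _ _))), ?_, hS.setNat (by simp) _ _, p,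
      ⟨hpath, hL⟩, by omega, hp.congr fun i _ => by simp, ?_, ?_, ?_, ?_, ?_, ?_, ?_, ?_⟩
    · have : (NatExpr.get 4 0).cost + (NatExpr.get 20 0 - NatExpr.get 5 (NatExpr.get 4 0)).cost + 1
          ≤ 20 := by decide
      omega
    · simpa using h5
    · simp [e4, hend, h5]
    · simpa using hend
    · intro j hj
      simpa using h5' j hj
    · intro j hj
      simpa [e4, hj] using h6 j hj
    · simpa using h7
    · simpa using hu
    · simpa using hu' hpath.ne_nil

theorem reach_updatePrices (h : HoldsInstance G L k N μ) {p : List (Fin m)} (hnodup : p.Nodup)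
    {y : Fin m → ℝ} (hy : ∀ e : Fin m, μ.real 3 e = y e) {J a : ℕ} (hJ : μ.nat 4 0 = J)
    (hp : HoldsPath p a μ) (h5 : μ.nat 5 J = a) (h6 : μ.nat 6 J = p.length) {u : ℝ}
    (hu : μ.real 5 0 = u) :
    Reach updatePrices μ (p.length * 100 + 200) (fun μ' => SameExcept [4, 21] [2, 3] μ μ' ∧
      μ'.nat 4 0 = J + 1 ∧ μ'.real 2 J = u / N ∧ (∀ j, j ≠ J → μ'.real 2 j = μ.real 2 j) ∧
      ∀ e : Fin m, μ'.real 3 e = if e ∈ p then y e * (1 + u / (k * G.cap e)) else y e) := by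
  have hamount : Reach (.setReal 2 (.get 4 0) (.get 5 0 / .ofNat (.get 11 0))) μ 20 (fun μ₁ =>
      SameExcept [4, 21] [2, 3] μ μ₁ ∧ μ₁.nat 4 0 = J ∧
      μ₁.real 2 J = u / N ∧ (∀ j, j ≠ J → μ₁.real 2 j = μ.real 2 j) ∧
      ∀ e : Fin m, μ₁.real 3 e = y e) := by
    refine Reach.of_wp ?_ (by decide)
    simp only [Program.wp]
    refine ⟨(SameExcept.refl _ _ _).setReal (by simp) _ _, by simp [hJ], ?_, fun j hj => ?_,
      fun e => ?_⟩
    · simp [hJ, hu, h.scale]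
    · simp [hJ, hj]
    · simp [hy]
  -- the edges of `p` are distinct, so every price on `p` is updated exactly once
  refine (hamount.seq fun μ₁ h₁ => (Reach.forLoop (T := 60) (N := p.length) (fun i μ₂ =>
      SameExcept [4, 21] [2, 3] μ μ₂ ∧ μ₂.nat 4 0 = J ∧
      μ₂.real 2 J = u / N ∧ (∀ j, j ≠ J → μ₂.real 2 j = μ.real 2 j) ∧
      ∀ e : Fin m, μ₂.real 3 e = if e ∈ p.take i then y e * (1 + u / (k * G.cap e)) else y e)
      (by decide) ?_ ?_ ?_).seq (T' := 20) fun μ₂ h₂ => ?_).mono ?_ fun _ => id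
  · obtain ⟨hS, h4, h2, h2', h3⟩ := h₁
    exact ⟨hS.setNat (by simp) _ _, by simpa using h4, by simpa using h2, by simpa using h2',
      by simpa using h3⟩
  · rintro i μ₂ ⟨hS, h4, -⟩
    simp [h4, hS.1 6 (by decide), h6]
  · rintro i μ₂ hi hc ⟨hS, h4, h2, h2', h3⟩
    have hinst := h.of_sameExcept hS (by decide) (by decide)
    have e5 : μ₂.nat 5 J = a := by rw [hS.1 5 (by decide), h5]
    have e7 : μ₂.nat 7 (a + i) = p[i] := by rw [hS.1 7 (by decide), hp.getElem hi]
    have eu : μ₂.real 5 0 = u := by rw [hS.2 5 (by decide), hu]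
    have hnot : p[i] ∉ p.take i := by
      intro hmem
      obtain ⟨j, hj, hj'⟩ := List.getElem_of_mem hmem
      simp at hj hj'
      have := (hnodup.getElem_inj_iff).1 hj'
      omega
    refine Reach.of_wp ?_ (by decide)
    simp only [Program.wp]
    refine ⟨by simpa using hc, (hS.setReal (by simp) _ _).setNat (by simp) _ _, by simpa using h4,
      by simpa using h2, by simpa using h2', fun e => ?_⟩
    have hmem : e ∈ p.take (i + 1) ↔ e ∈ p.take i ∨ e = p[i] := by
      rw [List.take_succ_eq_append_getElem hi, List.mem_append, List.mem_singleton]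
    simp only [hmem]
    by_cases he : e = p[i]
    · subst he
      simp [hc, h4, e5, e7, eu, hinst.step, hinst.cap, h3, hnot]
    · have he' : (e : ℕ) ≠ p[i] := fun h' => he (Fin.ext h')
      simp [hc, h4, e5, e7, he, he', h3]
  · obtain ⟨hS, h4, h2, h2', h3⟩ := h₂
    refine Reach.of_wp ?_ (by decide)
    simp only [Program.wp]
    refine ⟨hS.setNat (by simp) _ _, by simp [h4], by simpa using h2, by simpa using h2', ?_⟩
    simpa using h3
  · omega

/-! ### The main loop -/

/-- The invariant of the main loop after `i` rounds: the memory represents edge prices and a list of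
augmentations for which the price invariant holds, and the memory for tables is still zero from
position `b` on. -/
def RoundState (G : Network n m) (L k q N i b : ℕ) (μ : Memory) : Prop :=
  HoldsInstance G L k N μ ∧
  ∃ (y : Fin m → ℝ) (r J : ℕ) (p : ℕ → List (Fin m)),
    PriceInvariant G L k q N y r
      (∑ j ∈ Finset.range J, Finsupp.single (p j) (μ.real 2 j)) J ∧
    i = r + J ∧ r + 3 ≤ N ∧ (∀ e : Fin m, μ.real 3 e = y e) ∧
    μ.real 4 0 = (1 + 1 / (k : ℝ)) ^ r ∧ μ.nat 10 0 = r ∧ μ.nat 4 0 = J ∧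
    (∀ j, b ≤ j → μ.nat 14 j = 0) ∧
    ∀ j < J, HoldsPath (p j) (μ.nat 5 j) μ ∧ μ.nat 6 j = (p j).length ∧
      μ.nat 5 j + μ.nat 6 j ≤ μ.nat 20 0 ∧ 0 ≤ μ.real 2 j

/-- The index `i` counts both raises and augmentations. There are fewer than `N` raises, and at
most `m * N` augmentations because each one multiplies the product of the prices by at least
`1 + 1 / k`. -/
theorem reach_mainRound (hk : 0 < k) {q i : ℕ} (hq : (L : ℝ) ≤ (1 + 1 / (k : ℝ)) ^ q)
    (h : RoundState G L k q N i (μ.nat 16 0) μ)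
    (hb : (Test.natLe (.get 10 0 + 4) (.get 11 0)).Holds μ) :
    i < (m + 1) * N ∧ Reach mainRound μ (1000 * ((m + 1) * (n * (k + 2) + 1)))
      (fun μ' => RoundState G L k q N (i + 1) (μ'.nat 16 0) μ') := by
  obtain ⟨hG, y, r, J, p, hinv, rfl, hr, hy, hα, h10, h4, hfree, hpaths⟩ := h
  have hlt : r + 4 ≤ N := by simpa [h10, hG.scale] using hb
  have hy0 : ∀ e, 0 < y e := fun e => by linarith [hinv.one_le e]
  have hα0 : (0 : ℝ) < (1 + 1 / (k : ℝ)) ^ r := by positivity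
  refine ⟨?_, ?_⟩
  · have h1 := hinv.count_le hk
    have h2 : m * (r + 3) ≤ m * N := Nat.mul_le_mul_left _ hr
    rw [Nat.add_mul]
    omega
  obtain ⟨b, hb⟩ : ∃ b, μ.nat 16 0 = b := ⟨_, rfl⟩
  rw [hb] at hfree
  set K := n * (k + 2) with hK
  refine ((reach_roundWeights hG hy hy0 hα).seq (T' := K * ((m + 1) * 170 + 350) + 500)
    (Q' := fun μ' => RoundState G L k q N (r + J + 1) (μ'.nat 16 0) μ') fun μ₁ h₁ => ?_).mono
    (by ring_nf; nlinarith [Nat.zero_le (K * m)]) fun _ => id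
  obtain ⟨hS₁, w, hw, hw₁⟩ := h₁
  have hG₁ := hG.of_sameExcept hS₁ (by decide) (by decide)
  have hb₁ : μ₁.nat 16 0 = b := by rw [hS₁.1 16 (by decide), hb]
  refine ((reach_fillTable hG₁ hw₁ hw.pos hb₁
    (by rw [hS₁.1 14 (by decide)]; exact hfree)).seq (T' := K * 300 + 440)
    (Q' := fun μ' => RoundState G L k q N (r + J + 1) (μ'.nat 16 0) μ') fun μ₂ h₂ => ?_).mono
    (by rw [← hK]; ring_nf; omega) fun _ => id
  obtain ⟨hS₂, κ, hκK, h17, ht, hmin, hpos⟩ := h₂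
  rw [← hK] at hκK hpos
  have hG₂ := hG₁.of_sameExcept hS₂ (by decide) (by decide)
  have hS : SameExcept [12, 13, 14, 15, 17] [] μ μ₂ :=
    (hS₁.mono (by decide) (by decide)).trans (hS₂.mono (by decide) (by decide))
  have hb₂ : μ₂.nat 16 0 = b := by rw [hS.1 16 (by decide), hb]
  have hfree₂ : ∀ j, b + n * (K + 1) ≤ j → μ₂.nat 14 j = 0 := fun j hj => ht.eq_zero hκK hj
  have hw₂ : ∀ e : Fin m, μ₂.nat 13 e = w e := by rw [hS₂.1 13 (by decide)]; exact hw₁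
  have e2 := hS.2 2 (by decide)
  have e3 := hS.2 3 (by decide)
  have e4r := hS.2 4 (by decide)
  have e4 := hS.1 4 (by decide)
  have e5 := hS.1 5 (by decide)
  have e6 := hS.1 6 (by decide)
  have e7 := hS.1 7 (by decide)
  have e10 := hS.1 10 (by decide)
  have e20 := hS.1 20 (by decide)
  have hbranch : Reach (.cond (.natLe (.get 14 (cell (.get 17 0) (.get 0 2))) 0)
      raiseEstimate (tracePath ;; updatePrices)) μ₂ (20 + (K * 250 + 300)) (fun μ₃ =>
      μ₃.nat 16 0 = b ∧ RoundState G L k q N (r + J + 1) (b + n * (K + 1)) μ₃) := by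
    refine (Reach.cond (T := K * 250 + 300) (fun hle => ?_) fun hle => ?_).mono
      (Nat.add_le_add_right (by decide) _) fun _ => id
    · have hzero : μ₂.nat 14 (b + κ * n + G.source) = 0 := by
        simpa [h17, hb₂, hG₂.vertices, hG₂.source] using hle
      obtain rfl : κ = K := by
        by_contra hne
        have := hpos (by omega)
        omega
      have hd : ∀ p ∈ G.boundedPaths L, (1 + 1 / (k : ℝ)) ^ (r + 1) ≤ (p.map y).sum := by
        intro p hp
        have hweight := ht.lt_weight_of_isPath (fun κ' hκ' => by
          rcases Nat.lt_or_eq_of_le hκ' with h' | rfl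
          · exact hmin κ' h'
          · exact hzero) hp
        rw [pow_succ]
        exact hw.le_price hk hα0 hp.1 hweight
      refine Reach.of_wp (P := raiseEstimate) ?_ (le_trans (by decide : _ ≤ 300) (by omega))
      simp only [Program.wp, raiseEstimate]
      have hSf : SameExcept [10] [4] μ₂ ((μ₂.setReal 4 0 (μ₂.real 4 0 *
          (1 + 1 / (μ₂.nat 8 0 : ℝ)))).setNat 10 0 (μ₂.nat 10 0 + 1)) :=
        ((SameExcept.refl _ _ _).setReal (by simp) _ _).setNat (by simp) _ _
      refine ⟨by simp [hb₂], by
        simpa using hG₂.of_sameExcept hSf (by decide) (by decide), y, r + 1, J, p, ?_, by omega,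
        hlt, ?_, ?_, ?_, ?_, ?_, ?_⟩
      · simpa [e2] using hinv.raise hk hq hd
      · simpa [e3] using hy
      · simp [e4r, hα, hG₂.step, pow_succ]
      · simp [e10, h10]
      · simp [e4, h4]
      · simpa using hfree₂
      · intro j hj
        obtain ⟨h1, h2, h3, h5⟩ := hpaths j hj
        refine ⟨?_, by simpa [e6] using h2, by simpa [e5, e6, e20] using h3, by simpa [e2] using h5⟩
        simpa [e5] using h1.congr (fun i _ => by simp [e7])
    · have hpos' : 0 < μ₂.nat 14 (b + κ * n + G.source) := by
        simp [h17, hb₂, hG₂.vertices, hG₂.source] at hle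
        omega
      obtain ⟨a, ha⟩ : ∃ a, μ.nat 20 0 = a := ⟨_, rfl⟩
      refine ((reach_tracePath hG₂ hw₂ hw.pos hb₂ h17 ht hmin hpos' (by rw [e4, h4])
        (by rw [e20, ha])).seq (T' := κ * 100 + 200)
        (Q' := fun μ₃ => μ₃.nat 16 0 = b ∧ RoundState G L k q N (r + J + 1) (b + n * (K + 1)) μ₃)
        fun μ₃ h₃ => ?_).mono (by omega) fun _ => id
      obtain ⟨hS₃, p', hp', hweight, hp'₃, h5, h6, h20, h5', h6', h7, hu, hu'⟩ := h₃
      have hG₃ := hG₂.of_sameExcept hS₃ (by decide) (by decide)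
      have hlen : p'.length ≤ κ := hweight ▸ length_le_sum_map hw.pos p'
      refine (reach_updatePrices hG₃ hp'.1.nodup (y := y)
        (by rw [hS₃.2 3 (by decide), e3]; exact hy)
        (by rw [hS₃.1 4 (by decide), e4, h4]) hp'₃ h5 h6 rfl).mono (by omega) ?_
      rintro μ₄ ⟨hS₄, g4, g2, g2', g3⟩
      have hprice := hw.price_le hk G.source.pos hα0 (p := p') (by rw [hweight]; exact hκK)
      have hinv' := hinv.augment hk (by omega) hp' hprice hu hu'
      have f2 := hS₃.2 2 (by decide)
      have f5 := hS₄.1 5 (by decide)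
      have f6 := hS₄.1 6 (by decide)
      have f7 := hS₄.1 7 (by decide)
      have f20 := hS₄.1 20 (by decide)
      refine ⟨by rw [hS₄.1 16 (by decide), hS₃.1 16 (by decide), hb₂],
        hG₃.of_sameExcept hS₄ (by decide) (by decide), _, r, J + 1,
        fun j => if j = J then p' else p j, ?_, by omega, hr, g3, ?_, ?_, g4, ?_, ?_⟩
      · rw [Finset.sum_range_succ]
        beta_reduce
        rw [if_pos rfl, g2]
        convert hinv' using 2
        refine Finset.sum_congr rfl fun j hj => ?_
        have hj' := (Finset.mem_range.1 hj).ne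
        rw [if_neg hj', g2' j hj', f2, e2]
      · rw [hS₄.2 4 (by decide), hS₃.2 4 (by decide), e4r, hα]
      · rw [hS₄.1 10 (by decide), hS₃.1 10 (by decide), e10, h10]
      · rw [hS₄.1 14 (by decide), hS₃.1 14 (by decide)]
        exact hfree₂
      · intro j hj
        beta_reduce
        rcases Nat.lt_succ_iff_lt_or_eq.1 hj with hj' | rfl
        · obtain ⟨h1, h2, h3, h8⟩ := hpaths j hj'
          rw [if_neg hj'.ne, f5, f6, f20, h5' j hj'.ne, h6' j hj'.ne, h20, e5, e6,
            g2' j hj'.ne, f2, e2]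
          refine ⟨h1.congr fun i hi => ?_, h2, by omega, h8⟩
          rw [f7, h7 _ (by omega), e7]
        · rw [if_pos rfl, f5, f6, f20, h5, h6, h20, g2]
          refine ⟨hp'₃.congr fun i _ => by rw [f7], rfl, le_rfl, ?_⟩
          obtain ⟨e, -, he⟩ := hu'
          rw [he]
          exact div_nonneg (G.cap_pos e).le (Nat.cast_nonneg _)
  refine (hbranch.seq (T' := 20)
    (Q' := fun μ' => RoundState G L k q N (r + J + 1) (μ'.nat 16 0) μ') fun μ₃ h₃ => ?_).mono
    (by omega) fun _ => id
  obtain ⟨h16, hG₃, y', r', J', p', hR⟩ := h₃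
  refine Reach.of_wp ?_ (by decide)
  simp only [Program.wp]
  have hSf : SameExcept [16] [] μ₃ (μ₃.setNat 16 (NatExpr.eval μ₃ 0)
      (NatExpr.eval μ₃ (.get 16 0 + .get 0 0 * (.get 18 0 + 1)))) :=
    (SameExcept.refl _ _ _).setNat (by simp) _ _
  refine ⟨hG₃.of_sameExcept hSf (by decide) (by decide), y', r', J', p', ?_⟩
  simpa [HoldsPath, h16, hG₃.vertices, hG₃.threshold, hK] using hR

/-! ### Initialization and the total running time -/

theorem reach_chooseStep (G : Network n m) (L : ℕ) {ε : ℝ} (hε : 0 < ε) :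
    Reach chooseStep (inputMemory G L ε) (⌈4 / ε⌉₊ * 40 + 20) (fun μ =>
      SameExcept [8] [] (inputMemory G L ε) μ ∧ μ.nat 8 0 ≤ ⌈4 / ε⌉₊ ∧ 4 ≤ μ.nat 8 0 * ε) := by
  refine (Reach.loop (N := ⌈4 / ε⌉₊) (c := 20) (T := 20)
    (fun j μ => SameExcept [8] [] (inputMemory G L ε) μ ∧ μ.nat 8 0 = j) (by decide)
    ⟨SameExcept.refl _ _ _, rfl⟩ ?_).mono (by omega) ?_
  · rintro j μ ⟨hS, h8⟩ hb
    have h0 : μ.real 0 0 = ε := by rw [hS.2 0 (by decide)]; rfl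
    simp [h8, h0] at hb
    refine ⟨Nat.lt_ceil.2 ((lt_div_iff₀ hε).2 hb), Reach.of_wp ?_ (by decide)⟩
    simp only [Program.wp]
    exact ⟨hS.setNat (by simp) _ _, by simp [h8]⟩
  · rintro μ ⟨j, hj, ⟨hS, h8⟩, hb⟩
    have h0 : μ.real 0 0 = ε := by rw [hS.2 0 (by decide)]; rfl
    simp [h0] at hb
    exact ⟨hS, h8 ▸ hj, hb⟩

theorem reach_findLevel (hk : 0 < k) (hL : μ.nat 0 4 = L) (h8 : μ.nat 8 0 = k)
    (h9 : μ.nat 9 0 = 0) {M : ℕ} (hM : (L : ℝ) ≤ (1 + 1 / (k : ℝ)) ^ M) :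
    Reach findLevel μ (M * 60 + 40) (fun μ' => SameExcept [9] [6] μ μ' ∧
      μ'.nat 9 0 ≤ M ∧ (L : ℝ) ≤ (1 + 1 / (k : ℝ)) ^ μ'.nat 9 0) := by
  have hk' : (0 : ℝ) < k := by exact_mod_cast hk
  have hb1 : 1 ≤ 1 + 1 / (k : ℝ) := by simp
  have hinit : Reach (.setReal 6 0 1) μ 10 (fun μ₁ => SameExcept [9] [6] μ μ₁ ∧
      μ₁.nat 9 0 = 0 ∧ μ₁.real 6 0 = (1 + 1 / (k : ℝ)) ^ 0) := by
    refine Reach.of_wp ?_ (by decide)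
    simp only [Program.wp]
    exact ⟨(SameExcept.refl _ _ _).setReal (by simp) _ _, by simpa using h9, by simp⟩
  refine (hinit.seq fun μ₁ h₁ => Reach.loop (N := M) (c := 20) (T := 40)
    (fun j μ₂ => SameExcept [9] [6] μ μ₂ ∧ μ₂.nat 9 0 = j ∧
      μ₂.real 6 0 = (1 + 1 / (k : ℝ)) ^ j) (by decide) h₁ ?_).mono (by omega) ?_
  · rintro j μ₂ ⟨hS, h9, h6⟩ hb
    have e0 : μ₂.nat 0 4 = L := by rw [hS.1 0 (by decide), hL]
    have e8 : μ₂.nat 8 0 = k := by rw [hS.1 8 (by decide), h8]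
    have hb' : (1 + 1 / (k : ℝ)) ^ j < L := by simpa [e0, h6] using hb
    refine ⟨?_, Reach.of_wp ?_ (by decide)⟩
    · by_contra hcon
      have := pow_le_pow_right₀ hb1 (not_lt.1 hcon)
      linarith
    · simp only [Program.wp]
      refine ⟨(hS.setReal (by simp) _ _).setNat (by simp) _ _, by simp [h9], ?_⟩
      simp [h6, e8, pow_succ]
  · rintro μ₂ ⟨j, hj, ⟨hS, h9, h6⟩, hb⟩
    have e0 : μ₂.nat 0 4 = L := by rw [hS.1 0 (by decide), hL]
    refine ⟨hS, h9 ▸ hj, ?_⟩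
    have hb' : (L : ℝ) ≤ (1 + 1 / (k : ℝ)) ^ j := by simpa [e0, h6] using hb
    rwa [h9]

theorem reach_initPrices {ε : ℝ} {q : ℕ} (hS : SameExcept [8, 9] [6] (inputMemory G L ε) μ)
    (h8 : μ.nat 8 0 = k) (h9 : μ.nat 9 0 = q) (hk : 0 < k)
    (hq : (L : ℝ) ≤ (1 + 1 / (k : ℝ)) ^ q) :
    Reach initPrices μ ((m + 1) * 40 + 100)
      (fun μ' => RoundState G L k q (k * (q + k + 3)) 0 (μ'.nat 16 0) μ') := by
  set N := k * (q + k + 3) with hN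
  have e0 := hS.1 0 (by decide)
  have e1 := hS.1 1 (by decide)
  have e2 := hS.1 2 (by decide)
  have e3 := hS.1 3 (by decide)
  have e4 := hS.1 4 (by decide)
  have e10 := hS.1 10 (by decide)
  have e14 := hS.1 14 (by decide)
  have r1 := hS.2 1 (by decide)
  have hset : Reach (.setNat 11 0 (.get 8 0 * (.get 9 0 + .get 8 0 + 3)) ;;
      .setNat 18 0 (.get 0 0 * (.get 8 0 + 2)) ;; .setReal 4 0 1) μ 50 (fun μ₁ =>
      HoldsInstance G L k N μ₁ ∧ μ₁.real 4 0 = 1 ∧ μ₁.nat 10 0 = 0 ∧ μ₁.nat 4 0 = 0 ∧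
        ∀ j, μ₁.nat 14 j = 0) := by
    refine Reach.of_wp ?_ (by decide)
    simp only [Program.wp]
    refine ⟨⟨?_, ?_, ?_, ?_, ?_, ?_, ?_, ?_, ?_, ?_, ?_, ?_⟩, ?_, ?_, ?_, ?_⟩
    · simp [e0, inputMemory, arrayOf]
    · simp [e0, inputMemory, arrayOf]
    · simp [e0, inputMemory, arrayOf]
    · simp [e0, inputMemory, arrayOf]
    · simp [e0, inputMemory, arrayOf]
    · simp [e1, inputMemory, arrayOf]
    · simp [e2, inputMemory, arrayOf]
    · simp [e3, inputMemory, arrayOf]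
    · simp [r1, inputMemory, arrayOf]
    · simpa using h8
    · simp [h8, h9, hN]
    · simp [h8, e0, inputMemory, arrayOf]
    · simp
    · simp [e10, inputMemory]
    · simp [e4, inputMemory]
    · simp [e14, inputMemory]
  obtain ⟨μ₁, t, hx, ht, hG, h4, h10, hJ, h14⟩ := hset
  obtain ⟨μ₂, t', hx', ht', hS₂, h3⟩ := Reach.forLoop (c := 12) (bound := .get 0 1)
    (P := .setReal 3 (.get 12 0) 1) (μ := μ₁) (T := 20) (N := m)
    (fun i μ₂ => SameExcept [12] [3] μ₁ μ₂ ∧ ∀ e : Fin m, e < i → μ₂.real 3 e = 1) (by decide)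
    ⟨(SameExcept.refl _ _ _).setNat (by simp) _ _, by simp⟩
    (fun i μ₂ h => (hG.of_sameExcept h.1 (by decide) (by decide)).edges) (by
      rintro i μ₂ hi hc ⟨hS₂, h3⟩
      refine Reach.of_wp ?_ (by decide)
      simp only [Program.wp]
      refine ⟨by simpa using hc, (hS₂.setReal (by simp) _ _).setNat (by simp) _ _, fun e he => ?_⟩
      rcases Nat.lt_succ_iff_lt_or_eq.1 he with he | he
      · simp [hc, he.ne, h3 e he]
      · simp [hc, he])
  cases hx with
  | seq hx1 hx2 =>
    cases hx2 with
    | seq hx2 hx3 =>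
      refine ⟨μ₂, _, hx1.seq (hx2.seq (hx3.seq hx')), by omega,
        hG.of_sameExcept hS₂ (by decide) (by decide), fun _ => 1, 0, 0, fun _ => [], ?_, rfl, ?_,
        fun e => h3 e e.isLt, ?_, ?_, ?_, ?_, by simp⟩
      · simpa using PriceInvariant.init hq
      · rw [hN]
        nlinarith
      · rw [hS₂.2 4 (by decide), h4, pow_zero]
      · rw [hS₂.1 10 (by decide), h10]
      · rw [hS₂.1 4 (by decide), hJ]
      · intro j _
        rw [hS₂.1 14 (by decide), h14]

/-- The list of edge numbers in `HoldsFlow` is elaborated by coercing the list before the map. -/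
theorem list_map_coe_bind {m : ℕ} (p : List (Fin m)) :
    (p.map (fun e => (e : ℕ)) : List ℕ) = p.map fun e : Fin m => (e : ℕ) := by
  induction p with
  | nil => rfl
  | cons e p ih => simp_all

/-- In the final memory, the listed paths and amounts form the flow of the invariant. -/
theorem RoundState.holdsFlow {q i b : ℕ} (h : RoundState G L k q N i b μ) {ε : ℝ} (hε : 0 < ε)
    (hε1 : ε < 1) (hkε : 4 ≤ k * ε) (hN : N = k * (q + k + 3))
    (hb : ¬ (Test.natLe (.get 10 0 + 4) (.get 11 0)).Holds μ) :
    ∃ x, HoldsFlow μ x ∧ G.IsApproxMaxFlow L (1 + ε) x := by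
  obtain ⟨hG, y, r, J, p, hinv, -, hr, -, -, h10, h4, -, hpaths⟩ := h
  have hlt : ¬ r + 4 ≤ N := by simpa [h10, hG.scale] using hb
  refine ⟨_, ⟨p, fun j hj => ?_, by rw [h4]⟩, hinv.isApproxMaxFlow hε hε1 hkε hN (by omega)⟩
  obtain ⟨h1, h2, -, h3⟩ := hpaths j (h4 ▸ hj)
  refine ⟨?_, h3⟩
  rw [h2, list_map_coe_bind]
  exact h1

theorem reach_approxMaxFlow (G : Network n m) (L : ℕ) {ε : ℝ} (hε : 0 < ε) (hε1 : ε < 1) {M : ℕ}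
    (hM : ∀ k ≤ ⌈4 / ε⌉₊, 4 < k → (L : ℝ) ≤ (1 + 1 / (k : ℝ)) ^ M) :
    ∃ k q, k ≤ ⌈4 / ε⌉₊ ∧ q ≤ M ∧
      Reach approxMaxFlow (inputMemory G L ε)
        (⌈4 / ε⌉₊ * 40 + M * 60 + (m + 1) * 40 + 200 +
          (m + 1) * (k * (q + k + 3)) * (20 + 1000 * ((m + 1) * (n * (k + 2) + 1))))
        (fun μ => ∃ x, HoldsFlow μ x ∧ G.IsApproxMaxFlow L (1 + ε) x) := by
  obtain ⟨μ₁, t₁, hx₁, ht₁, hS₁, hk, hkε⟩ := reach_chooseStep G L hε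
  obtain ⟨k, h8⟩ : ∃ k, μ₁.nat 8 0 = k := ⟨_, rfl⟩
  rw [h8] at hk hkε
  have hk4 : (4 : ℝ) < k := by nlinarith
  have hk4' : 4 < k := by exact_mod_cast hk4
  have e0 := hS₁.1 0 (by decide)
  have e9 := hS₁.1 9 (by decide)
  obtain ⟨μ₂, t₂, hx₂, ht₂, hS₂, hqM, hq⟩ := reach_findLevel (μ := μ₁) (L := L) (by omega)
    (by simp [e0, inputMemory, arrayOf]) h8 (by simp [e9, inputMemory]) (hM k hk hk4')
  obtain ⟨q, h9⟩ : ∃ q, μ₂.nat 9 0 = q := ⟨_, rfl⟩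
  rw [h9] at hqM hq
  obtain ⟨μ₃, t₃, hx₃, ht₃, hR⟩ := reach_initPrices
    ((hS₁.mono (by decide) (by decide)).trans (hS₂.mono (by decide) (by decide)))
    (by rw [hS₂.1 8 (by decide), h8]) h9 (by omega) hq
  obtain ⟨μ₄, t₄, hx₄, ht₄, i, -, hR₄, hb₄⟩ := Reach.loop (c := 20)
    (b := .natLe (.get 10 0 + 4) (.get 11 0)) (P := mainRound)
    (fun i μ => RoundState G L k q (k * (q + k + 3)) i (μ.nat 16 0) μ) (by decide) hR
    fun i μ hI hb => reach_mainRound (by omega) hq hI hb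
  refine ⟨k, q, hk, hqM, μ₄, _, hx₁.seq (hx₂.seq (hx₃.seq hx₄)), ?_,
    hR₄.holdsFlow hε hε1 hkε rfl hb₄⟩
  omega

/-- The level `q` at which the estimate passes `L` is `O(k * log L)`. -/
theorem le_pow_ceil {k κ L : ℕ} (hk : 0 < k) (hκ : k ≤ κ) :
    (L : ℝ) ≤ (1 + 1 / (k : ℝ)) ^ ⌈(κ + 1) * Real.log L⌉₊ := by
  rcases Nat.eq_zero_or_pos L with rfl | hL
  · simp
  have hk' : (0 : ℝ) < k := by exact_mod_cast hk
  have hκ' : (k : ℝ) ≤ κ := by exact_mod_cast hκ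
  have hL' : (0 : ℝ) < L := by exact_mod_cast hL
  have hlog : 0 ≤ Real.log L := Real.log_natCast_nonneg L
  have h1 : 1 / ((k : ℝ) + 1) ≤ Real.log (1 + 1 / (k : ℝ)) := by
    refine le_trans (le_of_eq ?_) (Real.one_sub_inv_le_log_of_pos (by positivity))
    field_simp
    ring
  rw [← Real.log_le_log_iff hL' (by positivity), Real.log_pow]
  calc Real.log L = (k + 1) * Real.log L * (1 / ((k : ℝ) + 1)) := by field_simp
    _ ≤ (κ + 1) * Real.log L * Real.log (1 + 1 / (k : ℝ)) := by gcongr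
    _ ≤ _ := by
      refine mul_le_mul_of_nonneg_right (Nat.le_ceil _) ?_
      exact le_trans (by positivity) h1

/-- For `n = 2` the double logarithm is negative, but above `-log 2`. -/
theorem inv_le_log_log_add {n : ℕ} (hn : 2 ≤ n) {ε : ℝ} (hε : 0 < ε) (hε1 : ε < 1) :
    1 / ε ≤ 4 * (Real.log (Real.log n) + 1 / ε) := by
  have h2 : Real.log 2 ≤ Real.log n := Real.log_le_log (by norm_num) (by exact_mod_cast hn)
  have h3 : Real.log (1 / 2) ≤ Real.log (Real.log n) :=
    Real.log_le_log (by norm_num) (by linarith [Real.log_two_gt_d9])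
  have h4 : Real.log (1 / 2) = -Real.log 2 := by rw [one_div, Real.log_inv]
  have h5 : 1 ≤ 1 / ε := by rw [le_div_iff₀ hε]; linarith
  linarith [Real.log_two_lt_d9]

/-- The running time in terms of `κ`, which bounds `1 / ε`, and of `l = log L`. -/
theorem time_le {n m k q M c : ℕ} {κ l : ℝ} (hn : 2 ≤ n) (hm : 1 ≤ m) (hκ : 5 ≤ κ)
    (hl : 1 / 2 ≤ l) (hk : (k : ℝ) ≤ κ) (hc : (c : ℝ) ≤ κ) (hq : q ≤ M)
    (hM : (M : ℝ) ≤ (κ + 1) * l + 1) :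
    ((c * 40 + M * 60 + (m + 1) * 40 + 200 +
      (m + 1) * (k * (q + k + 3)) * (20 + 1000 * ((m + 1) * (n * (k + 2) + 1))) : ℕ) : ℝ) ≤
      1000000 * (κ ^ 3 * n * m ^ 2 * l) := by
  have hn' : (2 : ℝ) ≤ n := by exact_mod_cast hn
  have hm' : (1 : ℝ) ≤ m := by exact_mod_cast hm
  have hq' : (q : ℝ) ≤ M := by exact_mod_cast hq
  have hκl : κ ≤ 2 * (κ * l) := by nlinarith
  have hM' : (M : ℝ) ≤ 2 * (κ * l) := by nlinarith
  have hsum : (q : ℝ) + k + 3 ≤ 6 * (κ * l) := by linarith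
  have hN : (k : ℝ) * (q + k + 3) ≤ κ * (6 * (κ * l)) := by gcongr
  have hm2 : (m : ℝ) + 1 ≤ 2 * m := by linarith
  have hnk : (n : ℝ) * (k + 2) + 1 ≤ 2 * (n * κ) := by nlinarith
  have hnκ : 1 ≤ n * κ := by nlinarith
  have hmnκ : 1 ≤ m * (n * κ) := by nlinarith
  have hround : 20 + 1000 * (((m : ℝ) + 1) * (n * (k + 2) + 1)) ≤ 4020 * (m * (n * κ)) := by
    have : ((m : ℝ) + 1) * (n * (k + 2) + 1) ≤ (2 * m) * (2 * (n * κ)) := by gcongr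
    linarith
  have hloop : ((m : ℝ) + 1) * (k * (q + k + 3)) *
      (20 + 1000 * ((m + 1) * (n * (k + 2) + 1))) ≤
      (2 * m) * (κ * (6 * (κ * l))) * (4020 * (m * (n * κ))) := by gcongr
  have hX : κ * l * m ≤ κ ^ 3 * n * m ^ 2 * l := by
    have h1 : 1 ≤ κ * (m * (n * κ)) := by nlinarith
    have h2 : 0 ≤ κ * l * m := by positivity
    calc κ * l * m = κ * l * m * 1 := by ring
      _ ≤ κ * l * m * (κ * (m * (n * κ))) := by gcongr
      _ = _ := by ring
  have hκlm : κ * l ≤ κ * l * m := le_mul_of_one_le_right (by positivity) hm'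
  have hm3 : (m : ℝ) ≤ κ * l * m := le_mul_of_one_le_left (by positivity) (by nlinarith)
  push_cast
  have hloop' : (2 * (m : ℝ)) * (κ * (6 * (κ * l))) * (4020 * (m * (n * κ))) =
      48240 * (κ ^ 3 * n * m ^ 2 * l) := by ring
  linarith

end RealRAM

theorem mainTheorem2 :
    ∃ (A : RealRAM.Program) (C : ℝ), 0 < C ∧
      ∀ (n m : ℕ) (G : Network n m) (L : ℕ) (ε : ℝ), 0 < ε → ε < 1 →
        ∃ (μ : RealRAM.Memory) (T : ℕ) (x : List (Fin m) →₀ ℝ),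
          RealRAM.Exec A (RealRAM.inputMemory G L ε) μ T ∧
          RealRAM.HoldsFlow μ x ∧
          G.IsApproxMaxFlow L (1 + ε) x ∧
          (1 ≤ m → 2 ≤ L →
            (T : ℝ) ≤ C * ((m : ℝ) ^ 2 * n / ε ^ 2 * Real.log L *
              (Real.log (Real.log n) + 1 / ε))) := by
  refine ⟨RealRAM.approxMaxFlow, 500000000, by norm_num, fun n m G L ε hε hε1 => ?_⟩
  set c := ⌈4 / ε⌉₊ with hc
  obtain ⟨k, q, hk, hq, μ, T, hx, hT, x, hflow, happrox⟩ := RealRAM.reach_approxMaxFlow G L hε hε1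
    (M := ⌈(c + 1) * Real.log L⌉₊) fun k hk hk4 => RealRAM.le_pow_ceil (by omega) hk
  refine ⟨μ, T, x, hx, hflow, happrox, fun hm hL => ?_⟩
  have hn : 2 ≤ n := by
    have h1 := G.source.isLt
    have h2 := G.sink.isLt
    have h3 : (G.source : ℕ) ≠ G.sink := fun h => G.source_ne_sink (Fin.ext h)
    omega
  have hL2 : Real.log 2 ≤ Real.log L := Real.log_le_log (by norm_num) (by exact_mod_cast hL)
  have hl : 1 / 2 ≤ Real.log L := by linarith [Real.log_two_gt_d9]
  have hcε : (c : ℝ) ≤ 5 / ε := by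
    have h1 : (c : ℝ) < 4 / ε + 1 := Nat.ceil_lt_add_one (by positivity)
    have h2 : 1 ≤ 1 / ε := by rw [le_div_iff₀ hε]; linarith
    have h3 : 5 / ε = 4 / ε + 1 / ε := by ring
    linarith
  have hM : (⌈(c + 1) * Real.log L⌉₊ : ℝ) ≤ (5 / ε + 1) * Real.log L + 1 := by
    refine (Nat.ceil_lt_add_one (by positivity)).le.trans ?_
    gcongr
  have h5 : 5 ≤ 5 / ε := by rw [le_div_iff₀ hε]; linarith
  have htime := RealRAM.time_le (k := k) hn hm h5 hl
    ((Nat.cast_le.2 hk).trans hcε) hcε hq hM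
  calc (T : ℝ) ≤ 1000000 * ((5 / ε) ^ 3 * n * m ^ 2 * Real.log L) :=
        (Nat.cast_le.2 hT).trans htime
    _ = 125000000 * ((m : ℝ) ^ 2 * n / ε ^ 2 * Real.log L * (1 / ε)) := by field_simp; norm_num
    _ ≤ 125000000 * ((m : ℝ) ^ 2 * n / ε ^ 2 * Real.log L *
          (4 * (Real.log (Real.log n) + 1 / ε))) := by
        gcongr
        exact RealRAM.inv_le_log_log_add hn hε hε1
    _ = _ := by ring
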